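/- **Setting.** Let $n\ge 1$, let $\mu$ be Lebesgue measure on $\mathbb R^n$, $\operatorname{ci}(A)$ the closure of the interior of $A$, and $d_\mu(A,B)=\mu(A\,\Delta\,B)$. Let $\mathfrak L_n$ be the Lebesgue measurable sets of finite measure, where sets at $d_\mu$-distance $0$ are identified, and let $\mathfrak J_n$ be the bounded sets $A\subset\mathbb R^n$ with $A=\operatorname{ci}(A)$ and $\mu(\partial A)=0$. Fix constants $N>1$ and $\varepsilon>0$. The signed distance $d_S(p,A)$ of $p$ to $A\neq\emptyset$ is the Euclidean distance $d(p,\partial A)$ if $p\in A$ and $-d(p,\partial A)$ if $p\notin A$. **Measure average** $tA\oplus(1-t)B$ of $A,B\in\mathfrak J_n$ for $t\in[0,1]$. (i) For $B\subseteq A$ in $\mathfrak J_n$, $A\ne\emptyset$, and $x\in\mathbb R$ let $f_x(p)=x\,d_S(p,A)+(1-x)\,d_S(p,B)$, where for $B=\emptyset$ one puts $d_S(p,\emptyset)=-\|p-q\|$ with $q\in A$ a chosen maximizer of $d_S(\cdot,A)$; let $S_x=\{p: f_x(p)\ge 0\}$, $h(x)=\mu(S_x)$ and $T=t\mu(A)+(1-t)\mu(B)$.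 If $\mu(\{f_{1/2}=0\})=0$, put $tA\,\hat\oplus\,(1-t)B=\operatorname{ci}(S_g)$, where $g$ is any minimizer of $|h(\xi)-T|$ over $\xi\in[-N,N]$. Otherwise put $tA\,\hat\oplus\,(1-t)B=\operatorname{ci}(\{p:d(p,B)\le r\}\cap A)$, where $r\ge 0$ is any number with $\mu(\{p:d(p,B)\le r\}\cap A)=T$. (ii) For $B\subsetneq A$ in $\mathfrak J_n$ put $tA\oplus(1-t)B=\bigcup_C\big(t\operatorname{ci}(B\cup C)\,\hat\oplus\,(1-t)B\big)$, where, if $A\setminus B$ has finitely many connected components, $C$ runs over these components, and otherwise $C$ runs over the components of measure at least $\varepsilon$ and the union of all the other components. Also $tA\oplus(1-t)A=A$. (iii) For general $A,B\in\mathfrak J_n$ put $I=\operatorname{ci}(A\cap B)$ and $tA\oplus(1-t)B=\big(tA\oplus(1-t)I\big)\cup\big((1-t)B\oplus tI\big)$. **Spline subdivision of degree $m\ge1$.** Given $F^0_i\in\mathfrak J_n$ ($i\in\mathbb Z$), for $k\ge 0$ let $$F^{k+1,0}_{2i}=F^k_i,\quad F^{k+1,0}_{2i+1}=\tfrac12F^k_i\oplus\tfrac12F^k_{i+1},\quad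 F^{k+1,j}_i=\tfrac12F^{k+1,j-1}_i\oplus\tfrac12F^{k+1,j-1}_{i+1}\ (1\le j\le m-1),$$ $$F^{k+1}_i=F^{k+1,m-1}_{i-\lfloor (m-1)/2\rfloor},$$ and let $F_k(x)=\lambda F^k_i\oplus(1-\lambda)F^k_{i+1}$ with $\lambda=i+1-2^kx$ and $i=\lfloor 2^kx\rfloor$. A limit of the scheme is a function $F^\infty:\mathbb R\to\mathfrak L_n$ such that $d_\mu(F_k(x),F^\infty(x))\to0$ as $k\to\infty$, uniformly on bounded intervals. **Corollary.** Let $F^0_i\in\mathfrak J_n$, $i\in\mathbb Z$, be monotone non-decreasing, that is, $F^0_i\subseteq F^0_{i+1}$ for all $i$ (respectively non-increasing, that is, $F^0_i\supseteq F^0_{i+1}$ for all $i$). Then, for every $m\ge1$ and for all choices of constants and parameters left open above, the limit $F^\infty$ of the spline subdivision scheme of degree $m$ exists and is monotone non-decreasing (respectively non-increasing): for all real $x\le y$, $F^\infty(x)\subseteq F^\infty(y)$ (respectively $F^\infty(x)\supseteq F^\infty(y)$) up to a set of measure zero. -/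

import Mathlib

open MeasureTheory Set
open scoped symmDiff

namespace SetSpline

noncomputable section

/-- `ℝⁿ` with the Euclidean norm. -/
abbrev E (n : ℕ) : Type := EuclideanSpace ℝ (Fin n)

/-- The closure of the interior of a set. -/
def ci {n : ℕ} (A : Set (E n)) : Set (E n) := closure (interior A)

/-- The regular compact Jordan measurable subsets of `ℝⁿ`. -/
structure RegularJordan {n : ℕ} (A : Set (E n)) : Prop where
  bounded : Bornology.IsBounded A
  regular : A = ci A
  jordan : volume (frontier A) = 0

/-- The measure of the symmetric difference. -/
def dMu {n : ℕ} (A B : Set (E n)) : ENNReal := volume (A ∆ B)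

open Classical in
/-- The signed distance from `p` to a non-empty set `A`. -/
def signedDist {n : ℕ} (p : E n) (A : Set (E n)) : ℝ :=
  if p ∈ A then Metric.infDist p (frontier A) else -Metric.infDist p (frontier A)

/-- The points of `A` where the signed distance to `A` attains its supremum over `A`. -/
def centers {n : ℕ} (A : Set (E n)) : Set (E n) :=
  {q | q ∈ A ∧ ∀ a ∈ A, signedDist a A ≤ signedDist q A}

open Classical in
/-- The signed distance to `B`, when `B` is being averaged with `A`. If `B` is empty it is replaced
by minus the distance to the chosen center `c A` of `A`. -/
def partnerDist {n : ℕ} (c : Set (E n) → E n) (A : Set (E n)) (p : E n) (B : Set (E n)) : ℝ :=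
  if B = ∅ then -‖p - c A‖ else signedDist p B

/-- The function whose non-negativity set is the distance average of `A` and `B` with weights
`x` and `1 - x`. -/
def levelFun {n : ℕ} (c : Set (E n) → E n) (A B : Set (E n)) (x : ℝ) (p : E n) : ℝ :=
  x * partnerDist c B p A + (1 - x) * partnerDist c A p B

open Classical in
/-- The distance average of `A` and `B` with weights `x` and `1 - x`. -/
def distanceAverage {n : ℕ} (c : Set (E n) → E n) (A B : Set (E n)) (x : ℝ) : Set (E n) :=
  if A = ∅ ∧ B = ∅ then ∅ else {p | 0 ≤ levelFun c A B x p}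

/-- The measure of the distance average as a function of the weight. -/
def distanceAverageMeasure {n : ℕ} (c : Set (E n) → E n) (A B : Set (E n)) (x : ℝ) : ℝ :=
  volume.real (distanceAverage c A B x)

/-- The zero-measure condition: the level set of `levelFun` for weights `1/2`, `1/2` is null. -/
def ZeroMeasureCondition {n : ℕ} (c : Set (E n) → E n) (A B : Set (E n)) : Prop :=
  volume {p | levelFun c A B (1 / 2) p = 0} = 0

/-- The average of the measures of `A` and `B`. -/
def targetMeasure {n : ℕ} (A B : Set (E n)) (t : ℝ) : ℝ :=
  t * volume.real A + (1 - t) * volume.real B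

/-- The minimizers `x ∈ [-N, N]` of the difference between the measure of the distance average
with weights `x`, `1 - x` and the average of the measures with weights `t`, `1 - t`. -/
def reparamSet {n : ℕ} (c : Set (E n) → E n) (N : ℝ) (A B : Set (E n)) (t : ℝ) : Set ℝ :=
  {x | x ∈ Icc (-N) N ∧ ∀ ξ ∈ Icc (-N) N,
    |distanceAverageMeasure c A B x - targetMeasure A B t| ≤
      |distanceAverageMeasure c A B ξ - targetMeasure A B t|}

/-- The closed offset of radius `r` of `B`. -/
def offset {n : ℕ} (B : Set (E n)) (r : ℝ) : Set (E n) := {p | Metric.infDist p B ≤ r}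

/-- The radii `r` for which the offset of `B`, intersected with `A`, has the averaged measure. -/
def radiusSet {n : ℕ} (A B : Set (E n)) (t : ℝ) : Set ℝ :=
  {r | 0 ≤ r ∧ volume.real (offset B r ∩ A) = targetMeasure A B t}

/-- The constants (`N`, `ε`) and the arbitrary choices that the construction of the measure average
leaves open. Each choice is constrained only where there is something to choose from, so that
such choice functions exist trivially. -/
structure Choices (n : ℕ) where
  N : ℝ
  one_lt_N : 1 < N
  ε : ℝ
  ε_pos : 0 < ε
  center : Set (E n) → E n
  center_mem : ∀ A, (centers A).Nonempty → center A ∈ centers A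
  param : Set (E n) → Set (E n) → ℝ → ℝ
  param_mem : ∀ A B t, (reparamSet center N A B t).Nonempty →
    param A B t ∈ reparamSet center N A B t
  radius : Set (E n) → Set (E n) → ℝ → ℝ
  radius_mem : ∀ A B t, (radiusSet A B t).Nonempty → radius A B t ∈ radiusSet A B t

open Classical in
/-- The measure average, with weights `t ∈ [0, 1]` for `A` and `1 - t` for `B`, of sets `B ⊂ A`
such that `A \ B` is treated as a single component. -/
def simpleAverage {n : ℕ} (D : Choices n) (t : ℝ) (A B : Set (E n)) : Set (E n) :=
  if ZeroMeasureCondition D.center A B then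
    ci (distanceAverage D.center A B (D.param A B t))
  else
    ci (offset B (D.radius A B t) ∩ A)

/-- The connected components of a set. -/
def components {n : ℕ} (S : Set (E n)) : Set (Set (E n)) :=
  {C | ∃ p ∈ S, C = connectedComponentIn S p}

open Classical in
/-- The parts of `A \ B` that are averaged separately: the connected components if there are
finitely many of them; otherwise the components of measure at least `ε`, and the union of
all the other components as one further part. -/
def parts {n : ℕ} (ε : ℝ) (A B : Set (E n)) : Set (Set (E n)) :=
  if (components (A \ B)).Finite then components (A \ B)
  else {C | C ∈ components (A \ B) ∧ ε ≤ volume.real C} ∪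
    {⋃₀ {C | C ∈ components (A \ B) ∧ volume.real C < ε}}

open Classical in
/-- The measure average, with weights `t ∈ [0, 1]` for `A` and `1 - t` for `B`, of sets `B ⊆ A`.
If `A`, `B` are regular compact Jordan measurable and `A \ B` has finitely many components, then
`ci (B ∪ C) = B ∪ C` for each of these components; with infinitely many components, `B ∪ C` may
differ from `ci (B ∪ C)` by a null set, and `ci` makes it regular compact. -/
def nestedAverage {n : ℕ} (D : Choices n) (t : ℝ) (A B : Set (E n)) : Set (E n) :=
  if A = B then A else ⋃ C ∈ parts D.ε A B, simpleAverage D t (ci (B ∪ C)) B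

/-- The measure average of `A` and `B` with weights `t ∈ [0, 1]` for `A` and `1 - t` for `B`. -/
def measureAverage {n : ℕ} (D : Choices n) (t : ℝ) (A B : Set (E n)) : Set (E n) :=
  nestedAverage D t A (ci (A ∩ B)) ∪ nestedAverage D (1 - t) B (ci (A ∩ B))

/-- Doubling of a sequence of sets combined with one averaging step: `F i` goes to the position
`2 * i`, and the midpoint average of `F i` and `F (i + 1)` to the position `2 * i + 1`. -/
def doublingStep {n : ℕ} (D : Choices n) (F : ℤ → Set (E n)) (i : ℤ) : Set (E n) :=
  if Even i then F (i / 2) else measureAverage D (1 / 2) (F (i / 2)) (F (i / 2 + 1))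

/-- Replacement of a sequence by the midpoint averages of consecutive sets. -/
def averagingStep {n : ℕ} (D : Choices n) (F : ℤ → Set (E n)) (i : ℤ) : Set (E n) :=
  measureAverage D (1 / 2) (F i) (F (i + 1))

/-- One refinement step of the spline subdivision scheme of degree `m ≥ 1`. -/
def refine {n : ℕ} (D : Choices n) (m : ℕ) (F : ℤ → Set (E n)) (i : ℤ) : Set (E n) :=
  ((averagingStep D)^[m - 1] (doublingStep D F)) (i - (((m - 1) / 2 : ℕ) : ℤ))

/-- The sequence of sets at level `k`. -/
def level {n : ℕ} (D : Choices n) (m : ℕ) (F₀ : ℤ → Set (E n)) (k : ℕ) : ℤ → Set (E n) :=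
  (refine D m)^[k] F₀

/-- The piecewise interpolant through the sets of level `k` at the points `i / 2 ^ k`. -/
def interpolant {n : ℕ} (D : Choices n) (m : ℕ) (F₀ : ℤ → Set (E n)) (k : ℕ) (x : ℝ) :
    Set (E n) :=
  measureAverage D ((⌊x * 2 ^ k⌋ : ℝ) + 1 - x * 2 ^ k)
    (level D m F₀ k ⌊x * 2 ^ k⌋) (level D m F₀ k (⌊x * 2 ^ k⌋ + 1))

/-- `G` is a limit of the spline subdivision scheme of degree `m` applied to `F₀`: its values are
Lebesgue measurable sets of finite measure, and the interpolants converge to `G` in the symmetric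
difference metric, uniformly on bounded intervals. -/
structure IsLimit {n : ℕ} (D : Choices n) (m : ℕ) (F₀ : ℤ → Set (E n)) (G : ℝ → Set (E n)) :
    Prop where
  measurable : ∀ x, NullMeasurableSet (G x) volume
  finite : ∀ x, volume (G x) < ⊤
  tendsto : ∀ R : ℝ, ∀ δ : ENNReal, 0 < δ → ∃ K : ℕ, ∀ k, K ≤ k → ∀ x : ℝ, |x| ≤ R →
    dMu (interpolant D m F₀ k x) (G x) ≤ δ

end

end SetSpline

/-! For nested sets `B ⊆ A` the measure average lies between `B` and `A` and has measure exactly `t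
μ(A) + (1 - t) μ(B)` (`isMean_measureAverage`). For nested sets `d_μ` is the difference of the
measures, so along a monotone sequence the midpoint average is a metric midpoint. Doubling therefore
halves the distances between neighbours, and averaging steps do not enlarge a common bound on them.
Both preserve monotonicity. Interpolants of consecutive levels at `x` are caught between two sets of
level `k` that are `2m + 2` steps apart, so they differ by `O(2^(-k))` locally uniformly. The
sequence is thus geometrically Cauchy, with its limsup set as limit. For `x < y`, a set of level `k`
eventually separates the two interpolants, and the inclusion passes to the limit.

Exactness of the measure rests on an intermediate value argument: `h` is continuous on `[0, 1]` if
all the zero sets `{f_x = 0}` are null. For `0 < x < 1`, `x ≠ 1/2`, the two distances have unequal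
weights, so moving towards the nearest point of the heavier set changes `f_x` linearly. By the
Lebesgue density theorem the zero set is null (`volume_eq_zero_of_slope`). The case `x = 1/2` is the
zero-measure condition. It holds automatically for `B = ∅`, and when it fails the offsets of `B` are
used instead, whose level sets are null for the same reason. Summing over the finitely many disjoint
parts of `A \ B` gives the general nested case. -/

namespace SetSpline

/-! ### Null level sets and the signed distance -/

open Filter Topology Metric

variable {n : ℕ}

/-- A subset of the zero set of a Lipschitz function is null if at each of its points the function
grows at least linearly in some direction. -/
theorem volume_eq_zero_of_slope {S : Set (E n)} {f : E n → ℝ} {L : NNReal}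
    (hf : LipschitzWith L f) (h0 : ∀ p ∈ S, f p = 0)
    (h : ∀ p ∈ S, ∃ u : E n, ‖u‖ ≤ 1 ∧ ∃ a > 0, ∀ᶠ τ in 𝓝[>] (0 : ℝ), a * τ ≤ |f (p + τ • u)|) :
    volume S = 0 := by
  -- The density theorem is applied to balls centred at `p + τ • u` rather than at `p`; it only asks
  -- that `p` lie in a fixed dilate. The quantifier over `K` is inside, so that `K` may depend on
  -- `p`.
  have key : ∀ᵐ p ∂(volume.restrict S), ∀ K : ℕ, ∀ (w : ℝ → E n) (δ : ℝ → ℝ),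
      Tendsto δ (𝓝[>] (0 : ℝ)) (𝓝[>] 0) →
      (∀ᶠ τ in 𝓝[>] (0 : ℝ), p ∈ closedBall (w τ) (K * δ τ)) →
      Tendsto (fun τ => volume (S ∩ closedBall (w τ) (δ τ)) / volume (closedBall (w τ) (δ τ)))
        (𝓝[>] (0 : ℝ)) (𝓝 1) := by
    rw [ae_all_iff]
    intro K
    filter_upwards [IsUnifLocDoublingMeasure.ae_tendsto_measure_inter_div
      (volume : Measure (E n)) S K] with p hp w δ h1 h2 using hp w δ h1 h2
  rw [ae_iff] at key
  refine le_antisymm (le_trans (measure_mono ?_) (le_trans (Measure.le_restrict_apply _ _) key.le))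
    bot_le
  intro p hp
  refine ⟨fun hK => ?_, hp⟩
  obtain ⟨u, hu, a, ha, hev⟩ := h p hp
  have hL : (0 : ℝ) ≤ L := L.2
  -- On the ball of radius `c τ` about `p + τ • u` the function varies by at most `L c τ < a τ`, so
  -- the ball misses `S` and the density there is 0, not 1. Using `L + 1` covers `L = 0`.
  set c : ℝ := a / (2 * (L + 1)) with hc
  have hc0 : 0 < c := by positivity
  have hcL : L * c < a := by
    rw [hc, ← mul_div_assoc, div_lt_iff₀ (by positivity)]
    nlinarith
  obtain ⟨K, hKc⟩ := exists_nat_ge (1 / c)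
  have hKc' : 1 ≤ K * c := by rwa [div_le_iff₀ hc0] at hKc
  have hlim := hK K (fun τ => p + τ • u) (fun τ => c * τ) ?_ ?_
  · have hz : ∀ᶠ τ in 𝓝[>] (0 : ℝ),
        volume (S ∩ closedBall (p + τ • u) (c * τ)) / volume (closedBall (p + τ • u) (c * τ))
          = 0 := by
      filter_upwards [hev, self_mem_nhdsWithin] with τ hτ hτ0
      have hτ0' : (0 : ℝ) < τ := hτ0
      have : S ∩ closedBall (p + τ • u) (c * τ) = ∅ := by
        rw [eq_empty_iff_forall_notMem]
        rintro q ⟨hq, hqb⟩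
        have h1 := hf.dist_le_mul q (p + τ • u)
        rw [h0 q hq, Real.dist_eq, zero_sub, abs_neg] at h1
        have h2 : (L : ℝ) * dist q (p + τ • u) ≤ L * (c * τ) :=
          mul_le_mul_of_nonneg_left hqb hL
        nlinarith
      rw [this]
      simp
    have := tendsto_nhds_unique (hlim.congr' hz) tendsto_const_nhds
    exact one_ne_zero this
  · refine tendsto_nhdsWithin_iff.2 ⟨?_, ?_⟩
    · have : Tendsto (fun τ : ℝ => c * τ) (𝓝 0) (𝓝 (c * 0)) := tendsto_id.const_mul c
      rw [mul_zero] at this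
      exact this.mono_left nhdsWithin_le_nhds
    · filter_upwards [self_mem_nhdsWithin] with τ hτ
      exact mul_pos hc0 hτ
  · filter_upwards [self_mem_nhdsWithin] with τ hτ
    have hτ0' : (0 : ℝ) < τ := hτ
    rw [mem_closedBall, dist_eq_norm, sub_add_cancel_left, norm_neg, norm_smul, Real.norm_eq_abs,
      abs_of_pos hτ0']
    nlinarith

/-- From a point outside a closed set there is a direction in which the distance to the set
decreases at unit speed. -/
theorem exists_direction {K : Set (E n)} (hK : IsClosed K) (hne : K.Nonempty) {p : E n}
    (hp : p ∉ K) : ∃ u : E n, ‖u‖ = 1 ∧ p + infDist p K • u ∈ K ∧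
      ∀ τ, τ ≤ infDist p K → infDist (p + τ • u) K ≤ infDist p K - τ := by
  obtain ⟨b, hb, hd⟩ := hK.exists_infDist_eq_dist hne p
  have hs : 0 < infDist p K := (hK.notMem_iff_infDist_pos hne).1 hp
  set s := infDist p K with hsdef
  have hn : ‖b - p‖ = s := by rw [hd, dist_eq_norm, norm_sub_rev]
  obtain ⟨v, hv⟩ : ∃ v, v = s⁻¹ • (b - p) := ⟨_, rfl⟩
  have hbs : p + s • v = b := by
    rw [hv, smul_smul, mul_inv_cancel₀ hs.ne', one_smul, add_sub_cancel]
  have hv1 : ‖v‖ = 1 := by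
    rw [hv, norm_smul, hn, norm_inv, Real.norm_of_nonneg hs.le, inv_mul_cancel₀ hs.ne']
  refine ⟨v, hv1, hbs ▸ hb, fun τ hτ => ?_⟩
  refine (infDist_le_dist_of_mem hb).trans ?_
  rw [← hbs, dist_add_left, dist_eq_norm, ← sub_smul, norm_smul, hv1, mul_one, Real.norm_eq_abs,
    abs_sub_comm, abs_of_nonneg (sub_nonneg.2 hτ)]

theorem infDist_frontier_of_mem {A : Set (E n)} (hA : A ≠ univ) {p : E n} (hp : p ∈ A) :
    infDist p (frontier A) = infDist p Aᶜ := by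
  obtain ⟨y, hy, hd⟩ := exists_mem_frontier_infDist_compl_eq_dist hp hA
  refine le_antisymm (hd ▸ infDist_le_dist_of_mem hy) ?_
  rw [← infDist_closure (s := Aᶜ)]
  refine infDist_le_infDist_of_subset ?_ ⟨y, hy⟩
  rw [frontier_eq_closure_inter_closure]
  exact inter_subset_right

/-- Removes the case distinction: as a difference of two distance functions the signed distance is
visibly Lipschitz and monotone in the set. -/
theorem signedDist_eq {A : Set (E n)} (hne : A.Nonempty) (hA : A ≠ univ) (p : E n) :
    signedDist p A = infDist p Aᶜ - infDist p A := by
  unfold signedDist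
  split_ifs with hp
  · rw [infDist_frontier_of_mem hA hp, infDist_zero_of_mem hp, sub_zero]
  · have h : Aᶜ ≠ univ := fun h => hne.ne_empty (compl_univ_iff.1 h)
    have := infDist_frontier_of_mem h (p := p) hp
    rw [frontier_compl, compl_compl] at this
    rw [this, infDist_zero_of_mem (s := Aᶜ) hp, zero_sub]

theorem signedDist_of_notMem {A : Set (E n)} (hne : A.Nonempty) (hA : A ≠ univ) {p : E n}
    (hp : p ∉ A) : signedDist p A = -infDist p A := by
  rw [signedDist_eq hne hA, infDist_zero_of_mem (s := Aᶜ) hp, zero_sub]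

theorem lipschitz_signedDist {A : Set (E n)} (hne : A.Nonempty) (hA : A ≠ univ) :
    LipschitzWith 2 (fun p => signedDist p A) := by
  have : (fun p => signedDist p A) = fun p => infDist p Aᶜ - infDist p A :=
    funext fun p => signedDist_eq hne hA p
  rw [this, show (2 : NNReal) = 1 + 1 from one_add_one_eq_two.symm]
  exact (lipschitz_infDist_pt _).sub (lipschitz_infDist_pt _)

theorem frontier_nonempty_of_ne_univ {A : Set (E n)} (hne : A.Nonempty) (hA : A ≠ univ) :
    (frontier A).Nonempty := by
  obtain ⟨a, ha⟩ := hne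
  obtain ⟨y, hy, -⟩ := exists_mem_frontier_infDist_compl_eq_dist ha hA
  exact ⟨y, hy⟩

theorem signedDist_eq_zero_iff {A : Set (E n)} (hne : A.Nonempty) (hA : A ≠ univ) {p : E n} :
    signedDist p A = 0 ↔ p ∈ frontier A := by
  rw [isClosed_frontier.mem_iff_infDist_zero (frontier_nonempty_of_ne_univ hne hA)]
  unfold signedDist
  split_ifs <;> simp

theorem signedDist_nonneg_iff {A : Set (E n)} (hc : IsClosed A) (hne : A.Nonempty)
    (hA : A ≠ univ) {p : E n} : 0 ≤ signedDist p A ↔ p ∈ A := by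
  constructor
  · intro h
    by_contra hp
    rw [signedDist_of_notMem hne hA hp] at h
    have := (hc.notMem_iff_infDist_pos hne).1 hp
    linarith
  · intro hp
    rw [signedDist, if_pos hp]
    exact infDist_nonneg

theorem signedDist_mono {A B : Set (E n)} (hne : B.Nonempty) (hA : A ≠ univ) (hBA : B ⊆ A)
    (p : E n) : signedDist p B ≤ signedDist p A := by
  have hB : B ≠ univ := fun h => hA (univ_subset_iff.1 (h ▸ hBA))
  rw [signedDist_eq hne hB, signedDist_eq (hne.mono hBA) hA]
  exact sub_le_sub (infDist_le_infDist_of_subset (compl_subset_compl.2 hBA) (nonempty_compl.2 hA))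
    (infDist_le_infDist_of_subset hBA hne)

theorem _root_.IsCompact.ne_univ_of_nontrivial [Nontrivial (E n)] {A : Set (E n)}
    (hA : IsCompact A) : A ≠ univ := by
  rintro rfl
  exact noncompact_univ (E n) hA

/-- The convention for averaging with `∅` thus amounts to averaging with the singleton of the chosen
center. -/
theorem signedDist_singleton [Nontrivial (E n)] (p q : E n) :
    signedDist p {q} = -‖p - q‖ := by
  have hu := (isCompact_singleton (x := q)).ne_univ_of_nontrivial
  by_cases h : p = q
  · subst h
    rw [sub_self, norm_zero, neg_zero, signedDist_eq_zero_iff (singleton_nonempty p) hu]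
    simp [frontier]
  · rw [signedDist_of_notMem (singleton_nonempty q) hu h, infDist_singleton, dist_eq_norm]

end SetSpline

/-! ### Zero sets of weighted sums of signed distances -/

namespace SetSpline

open Filter Topology Metric

variable {n : ℕ}

/-- A pair of nested non-empty compact sets with null boundaries. -/
structure NestedBodies (A B : Set (E n)) : Prop where
  compact_outer : IsCompact A
  compact_inner : IsCompact B
  subset : B ⊆ A
  nonempty : B.Nonempty
  frontier_outer : volume (frontier A) = 0
  frontier_inner : volume (frontier B) = 0

/-- The weighted sum of two signed distances. -/
noncomputable def mixedDist (A B : Set (E n)) (x : ℝ) (p : E n) : ℝ :=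
  x * signedDist p A + (1 - x) * signedDist p B

theorem eventually_add_smul_mem {s : Set (E n)} {p : E n} (hs : s ∈ 𝓝 p) (u : E n) :
    ∀ᶠ τ in 𝓝[>] (0 : ℝ), p + τ • u ∈ s := by
  have : Tendsto (fun τ : ℝ => p + τ • u) (𝓝 0) (𝓝 (p + (0 : ℝ) • u)) :=
    Continuous.tendsto (by fun_prop) 0
  rw [zero_smul, add_zero] at this
  exact (this.mono_left nhdsWithin_le_nhds) hs

theorem exists_lipschitz_mixedDist {A B : Set (E n)} (hB : B.Nonempty) (hA : A ≠ univ)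
    (hBA : B ⊆ A) (x : ℝ) : ∃ L, LipschitzWith L (mixedDist A B x) := by
  have hB' : B ≠ univ := fun h => hA (univ_subset_iff.1 (h ▸ hBA))
  exact ⟨_, ((lipschitzWith_smul x).comp (lipschitz_signedDist (hB.mono hBA) hA)).add
    ((lipschitzWith_smul (1 - x)).comp (lipschitz_signedDist hB hB'))⟩

theorem signedDist_le_infDist_frontier (p : E n) (A : Set (E n)) :
    signedDist p A ≤ infDist p (frontier A) := by
  have := infDist_nonneg (x := p) (s := frontier A)
  unfold signedDist
  split_ifs <;> linarith

theorem infDist_add_smul_ge {u : E n} (hu : ‖u‖ = 1) (K : Set (E n)) (p : E n) {τ : ℝ}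
    (hτ : 0 ≤ τ) : infDist p K - τ ≤ infDist (p + τ • u) K := by
  have := infDist_le_infDist_add_dist (s := K) (x := p) (y := p + τ • u)
  rw [dist_self_add_right, norm_smul, hu, mul_one, Real.norm_of_nonneg hτ] at this
  linarith

variable [Nontrivial (E n)]

namespace NestedBodies

variable {A B : Set (E n)} (h : NestedBodies A B)
include h

omit [Nontrivial (E n)] in
theorem outer_nonempty : A.Nonempty := h.nonempty.mono h.subset

theorem outer_ne_univ : A ≠ univ := h.compact_outer.ne_univ_of_nontrivial

theorem inner_ne_univ : B ≠ univ := h.compact_inner.ne_univ_of_nontrivial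

theorem continuous_mixedDist (x : ℝ) : Continuous (mixedDist A B x) :=
  (exists_lipschitz_mixedDist h.nonempty h.outer_ne_univ h.subset x).choose_spec.continuous

theorem signedDist_le (p : E n) : signedDist p B ≤ signedDist p A :=
  signedDist_mono h.nonempty h.outer_ne_univ h.subset p

theorem mixedDist_mono (p : E n) : Monotone (fun x => mixedDist A B x p) := by
  intro x y hxy
  have := h.signedDist_le p
  simp only [mixedDist]
  nlinarith

theorem setOf_mixedDist_zero : {p | 0 ≤ mixedDist A B 0 p} = B := by
  ext p
  simp [mixedDist, signedDist_nonneg_iff h.compact_inner.isClosed h.nonempty h.inner_ne_univ]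

theorem setOf_mixedDist_one : {p | 0 ≤ mixedDist A B 1 p} = A := by
  ext p
  simp [mixedDist, signedDist_nonneg_iff h.compact_outer.isClosed h.outer_nonempty h.outer_ne_univ]

/-- Both weights are positive and the distance to `B` is the smaller one, so a zero sum forces
opposite signs; the distance to `B` vanishes only on its boundary. -/
theorem mem_sdiff_of_mixedDist_eq_zero {x : ℝ} (hx0 : 0 < x) (hx1 : x < 1) {p : E n}
    (hp : mixedDist A B x p = 0) (hpB : p ∉ frontier B) : p ∈ A \ B := by
  have hle := h.signedDist_le p
  have hA := signedDist_nonneg_iff h.compact_outer.isClosed h.outer_nonempty h.outer_ne_univ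
    (p := p)
  have hB := signedDist_nonneg_iff h.compact_inner.isClosed h.nonempty h.inner_ne_univ (p := p)
  have hB0 := signedDist_eq_zero_iff h.nonempty h.inner_ne_univ (p := p)
  unfold mixedDist at hp
  constructor
  · rw [← hA]
    by_contra hc
    push Not at hc
    nlinarith
  · rw [← hB]
    intro hc
    have : 0 < signedDist p B := lt_of_le_of_ne hc fun h => hpB (hB0.1 h.symm)
    nlinarith

/-- Off both boundaries a zero lies in `A \ B`, where the function is `x d(p, ∂A) - (1 - x) d(p,
B)`. The distance of larger weight can be decreased at unit speed while the other varies at most at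
unit speed, which leaves a slope `|1 - 2x|`. At weight `1/2` the two may cancel. -/
theorem volume_mixedDist_eq_zero {x : ℝ} (hx : x ∈ Icc (0 : ℝ) 1) (hx2 : x ≠ 1 / 2) :
    volume {p | mixedDist A B x p = 0} = 0 := by
  rcases hx.1.eq_or_lt with rfl | hx0
  · convert h.frontier_inner using 2
    ext p
    simp [mixedDist, signedDist_eq_zero_iff h.nonempty h.inner_ne_univ]
  rcases hx.2.eq_or_lt with rfl | hx1
  · convert h.frontier_outer using 2
    ext p
    simp [mixedDist, signedDist_eq_zero_iff h.outer_nonempty h.outer_ne_univ]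
  have hS : volume ({p | mixedDist A B x p = 0} \ (frontier A ∪ frontier B)) = 0 := by
    obtain ⟨L, hL⟩ := exists_lipschitz_mixedDist h.nonempty h.outer_ne_univ h.subset x
    refine volume_eq_zero_of_slope hL (fun p hp => hp.1) ?_
    rintro p ⟨hp0, hpf⟩
    have hpfA : p ∉ frontier A := fun h => hpf (Or.inl h)
    have hpfB : p ∉ frontier B := fun h => hpf (Or.inr h)
    obtain ⟨hpA, hpB⟩ := h.mem_sdiff_of_mixedDist_eq_zero hx0 hx1 hp0 hpfB
    have hintA : p ∈ interior A := by
      rw [← self_sdiff_frontier]; exact ⟨hpA, hpfA⟩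
    have hfne := frontier_nonempty_of_ne_univ h.outer_nonempty h.outer_ne_univ
    have hpB_ev (u : E n) := eventually_add_smul_mem
      (h.compact_inner.isClosed.isOpen_compl.mem_nhds hpB) u
    have hAp : signedDist p A = infDist p (frontier A) := if_pos hpA
    have hBp := signedDist_of_notMem h.nonempty h.inner_ne_univ hpB
    have hp0' : x * signedDist p A + (1 - x) * signedDist p B = 0 := hp0
    rcases lt_or_gt_of_ne hx2 with hlt | hgt
    -- `B` has the larger weight: moving towards it increases the function.
    · obtain ⟨u, hu, -, hdir⟩ := exists_direction h.compact_inner.isClosed h.nonempty hpB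
      have hpos := (h.compact_inner.isClosed.notMem_iff_infDist_pos h.nonempty).1 hpB
      refine ⟨u, hu.le, 1 - 2 * x, by linarith, ?_⟩
      filter_upwards [hpB_ev u, eventually_add_smul_mem (isOpen_interior.mem_nhds hintA) u,
        self_mem_nhdsWithin, Ioc_mem_nhdsGT hpos] with τ h1 h2 h3 h4
      have h3' : (0 : ℝ) < τ := h3
      have e1 := hdir τ h4.2
      have e2 := signedDist_of_notMem h.nonempty h.inner_ne_univ h1
      have e3 : signedDist (p + τ • u) A = infDist (p + τ • u) (frontier A) :=
        if_pos (interior_subset h2)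
      have e4 := infDist_add_smul_ge hu (frontier A) p h3'.le
      refine le_trans ?_ (le_abs_self _)
      unfold mixedDist
      nlinarith
    -- `A` has the larger weight: moving towards its boundary decreases the function.
    · obtain ⟨u, hu, -, hdir⟩ := exists_direction isClosed_frontier hfne hpfA
      have hpos := (isClosed_frontier.notMem_iff_infDist_pos hfne).1 hpfA
      refine ⟨u, hu.le, 2 * x - 1, by linarith, ?_⟩
      filter_upwards [hpB_ev u, self_mem_nhdsWithin, Ioc_mem_nhdsGT hpos] with τ h1 h3 h4
      have h3' : (0 : ℝ) < τ := h3
      have e1 := hdir τ h4.2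
      have e2 := signedDist_of_notMem h.nonempty h.inner_ne_univ h1
      have e3 := signedDist_le_infDist_frontier (p + τ • u) A
      have e4 := infDist_add_smul_ge hu B p h3'.le
      refine le_trans ?_ (neg_le_abs _)
      unfold mixedDist
      nlinarith
  refine measure_mono_null (t := ({p | mixedDist A B x p = 0} \ (frontier A ∪ frontier B)) ∪
    (frontier A ∪ frontier B)) (fun p hp => ?_)
    (measure_union_null hS (measure_union_null h.frontier_outer h.frontier_inner))
  by_cases hf : p ∈ frontier A ∪ frontier B
  · exact Or.inr hf
  · exact Or.inl ⟨hp, hf⟩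

omit [Nontrivial (E n)] in
-- The distance drops at unit speed towards the nearest point. Positivity of `r` matters: the level
-- 0 is `B` itself.
theorem volume_infDist_eq {r : ℝ} (hr : 0 < r) : volume {p | infDist p B = r} = 0 := by
  refine volume_eq_zero_of_slope (f := fun p => infDist p B - r) (L := 1 + 0)
    ((lipschitz_infDist_pt B).sub (LipschitzWith.const r)) (fun p hp => sub_eq_zero.2 hp) ?_
  intro p hp
  have hp' : infDist p B = r := hp
  have hpos : 0 < infDist p B := hp' ▸ hr
  obtain ⟨u, hu, -, hdir⟩ := exists_direction h.compact_inner.isClosed h.nonempty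
    ((h.compact_inner.isClosed.notMem_iff_infDist_pos h.nonempty).2 hpos)
  refine ⟨u, hu.le, 1, one_pos, ?_⟩
  filter_upwards [Ioc_mem_nhdsGT hpos] with τ h4
  have e1 := hdir τ h4.2
  refine le_trans ?_ (neg_le_abs _)
  linarith

end NestedBodies

/-- If `q ∈ A` has positive maximal signed distance to `A`, then the points whose distances to `q`
and to the boundary of `A` are equal form a null set. -/
theorem volume_mixedDist_singleton_eq_zero {A : Set (E n)} {q : E n} (h : NestedBodies A {q})
    (hq : 0 < signedDist q A) : volume {p | mixedDist A {q} (1 / 2) p = 0} = 0 := by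
  have hS : volume ({p | mixedDist A {q} (1 / 2) p = 0} \ (frontier A ∪ frontier {q})) = 0 := by
    obtain ⟨L, hL⟩ := exists_lipschitz_mixedDist h.nonempty h.outer_ne_univ h.subset (1 / 2)
    refine volume_eq_zero_of_slope hL (fun p hp => hp.1) ?_
    rintro p ⟨hp0, hpf⟩
    have hpfA : p ∉ frontier A := fun h => hpf (Or.inl h)
    have hpfB : p ∉ frontier {q} := fun h => hpf (Or.inr h)
    obtain ⟨hpA, hpB⟩ := h.mem_sdiff_of_mixedDist_eq_zero (by norm_num) (by norm_num) hp0 hpfB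
    have hfne := frontier_nonempty_of_ne_univ h.outer_nonempty h.outer_ne_univ
    obtain ⟨u, hu, hmem, hdir⟩ := exists_direction isClosed_frontier hfne hpfA
    have hpos := (isClosed_frontier.notMem_iff_infDist_pos hfne).1 hpfA
    have hAp : signedDist p A = infDist p (frontier A) := if_pos hpA
    have heq : infDist p (frontier A) = ‖p - q‖ := by
      have hp0' : mixedDist A {q} (1 / 2) p = 0 := hp0
      rw [mixedDist, signedDist_singleton, hAp] at hp0'
      linarith
    set s := infDist p (frontier A) with hs
    have hqf : q ∉ frontier A := fun hf =>
      hq.ne' ((signedDist_eq_zero_iff h.outer_nonempty h.outer_ne_univ).2 hf)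
    obtain ⟨v, hv⟩ : ∃ v, v = s⁻¹ • (p - q) := ⟨_, rfl⟩
    have hpq : p - q = s • v := by rw [hv, smul_smul, mul_inv_cancel₀ hpos.ne', one_smul]
    have hv1 : ‖v‖ = 1 := by
      rw [hv, norm_smul, ← heq, norm_inv, Real.norm_of_nonneg hpos.le, inv_mul_cancel₀ hpos.ne']
    -- If `u = -v`, the boundary point reached from `p` along `u` at distance `s = ‖p - q‖` would be
    -- `q`, which is not on the boundary.
    have hne : inner ℝ u v ≠ -1 := by
      rw [Ne, inner_eq_neg_one_iff_of_norm_eq_one hu hv1]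
      rintro rfl
      apply hqf
      rwa [smul_neg, ← hpq, ← sub_eq_add_neg, sub_sub_cancel] at hmem
    have hge : -1 ≤ inner ℝ u v := by
      have := abs_le.1 (abs_real_inner_le_norm u v)
      rw [hu, hv1, mul_one] at this
      exact this.1
    have hgt : -1 < inner ℝ u v := lt_of_le_of_ne hge hne.symm
    -- The distance to the boundary falls at speed 1 and the distance to `q` grows at speed at least
    -- `⟨u, v⟩`; each has weight `1/2`.
    refine ⟨u, hu.le, (1 + inner ℝ u v) / 2, by linarith, ?_⟩
    filter_upwards [self_mem_nhdsWithin, Ioc_mem_nhdsGT hpos] with τ h3 h4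
    have e1 := hdir τ h4.2
    have e3 := signedDist_le_infDist_frontier (p + τ • u) A
    have e4 : s + τ * inner ℝ u v ≤ ‖p + τ • u - q‖ := by
      have := real_inner_le_norm (p + τ • u - q) v
      rw [hv1, mul_one] at this
      refine le_trans (le_of_eq ?_) this
      rw [add_sub_right_comm, inner_add_left, hpq, inner_smul_left, inner_smul_left,
        real_inner_self_eq_norm_sq, hv1]
      simp
    refine le_trans ?_ (neg_le_abs _)
    rw [mixedDist, signedDist_singleton]
    nlinarith
  refine measure_mono_null (t := ({p | mixedDist A {q} (1 / 2) p = 0} \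
    (frontier A ∪ frontier {q})) ∪ (frontier A ∪ frontier {q})) (fun p hp => ?_)
    (measure_union_null hS (measure_union_null h.frontier_outer h.frontier_inner))
  by_cases hf : p ∈ frontier A ∪ frontier {q}
  · exact Or.inr hf
  · exact Or.inl ⟨hp, hf⟩

end SetSpline

/-! ### The average over a single part has the prescribed measure -/

namespace SetSpline

open Filter Topology Metric

variable {n : ℕ}

theorem ci_mono {A B : Set (E n)} (h : A ⊆ B) : ci A ⊆ ci B :=
  closure_mono (interior_mono h)

theorem ci_subset_of_isClosed {A : Set (E n)} (h : IsClosed A) : ci A ⊆ A :=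
  closure_minimal interior_subset h

theorem ci_ci (A : Set (E n)) : ci (ci A) = ci A := by
  refine (ci_subset_of_isClosed isClosed_closure).antisymm ?_
  exact closure_mono (interior_maximal subset_closure isOpen_interior)

theorem ci_empty : ci (∅ : Set (E n)) = ∅ := by simp [ci]

theorem frontier_ci_subset (A : Set (E n)) : frontier (ci A) ⊆ frontier A :=
  frontier_closure_subset.trans frontier_interior_subset

theorem ci_ae_eq {A : Set (E n)} (h : volume (frontier A) = 0) : ci A =ᵐ[volume] A := by
  have h1 : interior A =ᵐ[volume] A := interior_ae_eq_of_null_frontier h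
  have h2 : closure (interior A) =ᵐ[volume] interior A :=
    closure_ae_eq_of_null_frontier (measure_mono_null frontier_interior_subset h)
  exact h2.trans h1

theorem RegularJordan.isClosed {A : Set (E n)} (h : RegularJordan A) : IsClosed A := by
  rw [h.regular]; exact isClosed_closure

theorem RegularJordan.isCompact {A : Set (E n)} (h : RegularJordan A) : IsCompact A :=
  isCompact_of_isClosed_isBounded h.isClosed h.bounded

theorem RegularJordan.volume_ne_top {A : Set (E n)} (h : RegularJordan A) : volume A ≠ ⊤ :=
  h.bounded.measure_lt_top.ne

theorem RegularJordan.measurableSet {A : Set (E n)} (h : RegularJordan A) : MeasurableSet A :=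
  h.isClosed.measurableSet

theorem regularJordan_ci {A : Set (E n)} (hb : Bornology.IsBounded A)
    (hf : volume (frontier A) = 0) : RegularJordan (ci A) where
  bounded := hb.closure.subset (closure_mono interior_subset)
  regular := (ci_ci A).symm
  jordan := measure_mono_null (frontier_ci_subset A) hf

theorem regularJordan_empty : RegularJordan (∅ : Set (E n)) where
  bounded := Bornology.isBounded_empty
  regular := ci_empty.symm
  jordan := by simp

theorem subset_of_null_sdiff {U A : Set (E n)} (hU : IsOpen U) (hA : IsClosed A)
    (h : volume (U \ A) = 0) : U ⊆ A := by
  rw [← sdiff_eq_empty]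
  exact (hU.sdiff hA).eq_empty_of_measure_zero h

/-- Dominated convergence for the indicators, with the finite-measure set `A` as dominating set. -/
theorem continuousOn_volume_real {S : ℝ → Set (E n)} {s : Set ℝ} {A : Set (E n)}
    (hS : ∀ x, MeasurableSet (S x)) (hA : MeasurableSet A) (hA' : volume A ≠ ⊤)
    (hsub : ∀ x ∈ s, S x ⊆ A)
    (h : ∀ x ∈ s, ∀ᵐ p ∂(volume : Measure (E n)), ∀ᶠ y in 𝓝[s] x, (p ∈ S y ↔ p ∈ S x)) :
    ContinuousOn (fun x => volume.real (S x)) s := by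
  intro x hx
  have := tendsto_measure_of_ae_tendsto_indicator (μ := volume) (L := 𝓝[s] x) (hS x) hS hA hA'
    (by filter_upwards [self_mem_nhdsWithin] with y hy using hsub y hy) (h x hx)
  exact (ENNReal.tendsto_toReal (measure_ne_top_of_subset (hsub x hx) hA')).comp this

/-- The set `K` lies between `B` and `A` and has the averaged measure. -/
structure IsMean (t : ℝ) (A B K : Set (E n)) : Prop where
  regularJordan : RegularJordan K
  inner_subset : B ⊆ K
  subset_outer : K ⊆ A
  measure : volume.real K = targetMeasure A B t

theorem targetMeasure_mem {A B : Set (E n)} {t : ℝ} (ht : t ∈ Icc (0 : ℝ) 1)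
    (hle : volume.real B ≤ volume.real A) :
    targetMeasure A B t ∈ Icc (volume.real B) (volume.real A) := by
  obtain ⟨h0, h1⟩ := ht
  constructor <;> unfold targetMeasure <;> nlinarith

variable [Nontrivial (E n)]

namespace NestedBodies

variable {A B : Set (E n)} (h : NestedBodies A B)
include h

omit [Nontrivial (E n)] in
theorem volume_outer_ne_top : volume A ≠ ⊤ := h.compact_outer.measure_ne_top

omit [Nontrivial (E n)] in
theorem volume_real_le : volume.real B ≤ volume.real A :=
  measureReal_mono h.subset h.volume_outer_ne_top

theorem isClosed_setOf (x : ℝ) : IsClosed {p | 0 ≤ mixedDist A B x p} :=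
  isClosed_le continuous_const (h.continuous_mixedDist x)

theorem setOf_mixedDist_mono {x y : ℝ} (hxy : x ≤ y) :
    {p | 0 ≤ mixedDist A B x p} ⊆ {p | 0 ≤ mixedDist A B y p} :=
  fun p hp => le_trans hp (h.mixedDist_mono p hxy)

/-- Minimizers in `[-N, N]` may exceed 1, and then the set need not lie in `A`. Outside `A ⊆
closedBall 0 R` the function is at most `-y (‖p‖ - R) + (y - 1) (‖p‖ + R) = (2y - 1) R - ‖p‖`. -/
theorem isBounded_setOf (x : ℝ) : Bornology.IsBounded {p | 0 ≤ mixedDist A B x p} := by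
  suffices ∀ y : ℝ, 1 ≤ y → Bornology.IsBounded {p | 0 ≤ mixedDist A B y p} from
    (this (max x 1) (le_max_right _ _)).subset (h.setOf_mixedDist_mono (le_max_left _ _))
  intro y hy
  obtain ⟨R, hR⟩ := h.compact_outer.isBounded.subset_closedBall 0
  obtain ⟨b, hb⟩ := h.nonempty
  have hbR : ‖b‖ ≤ R := by simpa using hR (h.subset hb)
  refine isBounded_closedBall.subset (?_ : _ ⊆ closedBall (0 : E n) (2 * y * R))
  intro p hp
  have hp' : 0 ≤ y * signedDist p A + (1 - y) * signedDist p B := hp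
  rw [mem_closedBall_zero_iff]
  have hR0 : 0 ≤ R := (norm_nonneg b).trans hbR
  by_cases hpA : p ∈ A
  · have : ‖p‖ ≤ R := by simpa using hR hpA
    nlinarith
  · rw [signedDist_of_notMem h.outer_nonempty h.outer_ne_univ hpA,
      signedDist_of_notMem h.nonempty h.inner_ne_univ fun hpB => hpA (h.subset hpB)] at hp'
    have e1 : infDist p B ≤ ‖p‖ + R :=
      (infDist_le_dist_of_mem hb).trans (by rw [dist_eq_norm]; linarith [norm_sub_le p b])
    have e2 : ‖p‖ - R ≤ infDist p A := by
      refine (le_infDist h.outer_nonempty).2 fun a ha => ?_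
      have : ‖a‖ ≤ R := by simpa using hR ha
      rw [dist_eq_norm]
      linarith [norm_sub_norm_le p a]
    nlinarith

theorem frontier_setOf_subset (x : ℝ) :
    frontier {p | 0 ≤ mixedDist A B x p} ⊆ {p | mixedDist A B x p = 0} :=
  fun _ hp => (frontier_le_subset_eq continuous_const (h.continuous_mixedDist x) hp).symm

theorem continuousOn_volume_real_mixedDist
    (hz : ∀ x ∈ Icc (0 : ℝ) 1, volume {p | mixedDist A B x p = 0} = 0) :
    ContinuousOn (fun x => volume.real {p | 0 ≤ mixedDist A B x p}) (Icc 0 1) := by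
  refine continuousOn_volume_real (fun x => (h.isClosed_setOf x).measurableSet)
    h.compact_outer.measurableSet h.volume_outer_ne_top (fun x hx => ?_) (fun x hx => ?_)
  · conv_rhs => rw [← h.setOf_mixedDist_one]
    exact h.setOf_mixedDist_mono hx.2
  · have hae : ∀ᵐ p ∂(volume : Measure (E n)), mixedDist A B x p ≠ 0 := by
      rw [ae_iff]
      simpa using hz x hx
    filter_upwards [hae] with p hp
    have hc : Continuous fun y => mixedDist A B y p := by unfold mixedDist; fun_prop
    refine Filter.Eventually.filter_mono nhdsWithin_le_nhds ?_
    rcases lt_or_gt_of_ne hp with hlt | hgt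
    · filter_upwards [hc.continuousAt.eventually_lt continuousAt_const hlt] with y hy
      simp [hlt.not_ge, hy.not_ge]
    · filter_upwards [continuousAt_const.eventually_lt hc.continuousAt hgt] with y hy
      simp [hgt.le, hy.le]

theorem exists_volume_real_mixedDist_eq
    (hz : ∀ x ∈ Icc (0 : ℝ) 1, volume {p | mixedDist A B x p = 0} = 0) {T : ℝ}
    (hT : T ∈ Icc (volume.real B) (volume.real A)) :
    ∃ x ∈ Icc (0 : ℝ) 1, volume.real {p | 0 ≤ mixedDist A B x p} = T := by
  have := intermediate_value_Icc zero_le_one (h.continuousOn_volume_real_mixedDist hz)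
  rw [h.setOf_mixedDist_zero, h.setOf_mixedDist_one] at this
  exact this hT

/-- For `g ∈ [0, 1]` the boundary lies in a null zero set. A parameter outside `[0, 1]` can also
attain the target; then monotonicity and the measure bound force the set to agree with `B` (if `g <
0`) or `A` (if `g > 1`) up to a null set. An open set that is almost contained in a closed one is
contained in it, which yields the exact inclusions. -/
theorem ci_setOf_mixedDist
    (hz : ∀ x ∈ Icc (0 : ℝ) 1, volume {p | mixedDist A B x p = 0} = 0) {T g : ℝ}
    (hT : T ∈ Icc (volume.real B) (volume.real A))
    (hg : volume.real {p | 0 ≤ mixedDist A B g p} = T) :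
    RegularJordan (ci {p | 0 ≤ mixedDist A B g p}) ∧ ci B ⊆ ci {p | 0 ≤ mixedDist A B g p} ∧
      ci {p | 0 ≤ mixedDist A B g p} ⊆ A ∧ volume.real (ci {p | 0 ≤ mixedDist A B g p}) = T := by
  have hfin (x : ℝ) : volume {p | 0 ≤ mixedDist A B x p} ≠ ⊤ :=
    (h.isBounded_setOf x).measure_lt_top.ne
  have hcl := h.isClosed_setOf g
  have hbd := h.isBounded_setOf g
  have hzg := h.frontier_setOf_subset g
  have h0 := h.setOf_mixedDist_zero
  have h1 := h.setOf_mixedDist_one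
  have hm0 := fun hx : g ≤ 0 => h.setOf_mixedDist_mono hx
  have hm0' := fun hx : 0 ≤ g => h.setOf_mixedDist_mono hx
  have hm1 := fun hx : g ≤ 1 => h.setOf_mixedDist_mono hx
  have hm1' := fun hx : 1 ≤ g => h.setOf_mixedDist_mono hx
  rw [h0] at hm0 hm0'
  rw [h1] at hm1 hm1'
  have hSfin := hfin g
  set S := {p | 0 ≤ mixedDist A B g p} with hS
  suffices volume (frontier S) = 0 ∧ interior B ⊆ S ∧ interior S ⊆ A by
    refine ⟨regularJordan_ci hbd this.1, closure_mono (interior_maximal this.2.1 isOpen_interior),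
      closure_minimal this.2.2 h.compact_outer.isClosed, ?_⟩
    rw [measureReal_congr (ci_ae_eq this.1), hg]
  rcases lt_or_ge g 0 with hneg | hpos
  · have hnull : volume (B \ S) = 0 := by
      have e := measureReal_sdiff (μ := volume) (hm0 hneg.le) hcl.measurableSet
        (h₁ := h.compact_inner.measure_ne_top)
      rw [hg] at e
      have e2 : volume.real (B \ S) = 0 :=
        le_antisymm (by rw [e]; linarith [hT.1]) measureReal_nonneg
      exact (measureReal_eq_zero_iff
        (measure_ne_top_of_subset sdiff_subset h.compact_inner.measure_ne_top)).1 e2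
    have hint : interior B ⊆ S := subset_of_null_sdiff isOpen_interior hcl
      (measure_mono_null (sdiff_subset_sdiff_left interior_subset) hnull)
    refine ⟨measure_mono_null ?_ h.frontier_inner, hint,
      interior_subset.trans ((hm0 hneg.le).trans h.subset)⟩
    rw [hcl.frontier_eq, h.compact_inner.isClosed.frontier_eq]
    exact fun p hp => ⟨hm0 hneg.le hp.1,
      fun hpB => hp.2 (interior_maximal hint isOpen_interior hpB)⟩
  rcases le_or_gt g 1 with hle | hgt
  · exact ⟨measure_mono_null hzg (hz g ⟨hpos, hle⟩), interior_subset.trans (hm0' hpos),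
      interior_subset.trans (hm1 hle)⟩
  · have hnull : volume (S \ A) = 0 := by
      have e := measureReal_sdiff (μ := volume) (hm1' hgt.le) h.compact_outer.measurableSet
        (h₁ := hSfin)
      rw [hg] at e
      have e2 : volume.real (S \ A) = 0 :=
        le_antisymm (by rw [e]; linarith [hT.2]) measureReal_nonneg
      exact (measureReal_eq_zero_iff (measure_ne_top_of_subset sdiff_subset hSfin)).1 e2
    refine ⟨measure_mono_null ?_ (measure_union_null hnull h.frontier_outer),
      interior_subset.trans (h.subset.trans (hm1' hgt.le)), subset_of_null_sdiff isOpen_interior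
        h.compact_outer.isClosed
        (measure_mono_null (sdiff_subset_sdiff_left interior_subset) hnull)⟩
    rw [hcl.frontier_eq, h.compact_outer.isClosed.frontier_eq]
    intro p hp
    by_cases hpA : p ∈ A
    · exact Or.inr ⟨hpA, fun hpi => hp.2 (interior_mono (hm1' hgt.le) hpi)⟩
    · exact Or.inl ⟨hp.1, hpA⟩

omit [Nontrivial (E n)] in
theorem offset_zero : offset B 0 = B := by
  ext p
  rw [offset, mem_ofPred_eq, h.compact_inner.isClosed.mem_iff_infDist_zero h.nonempty]
  exact ⟨fun hp => le_antisymm hp infDist_nonneg, le_of_eq⟩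

omit [Nontrivial (E n)] h in
theorem isClosed_offset (B : Set (E n)) (r : ℝ) : IsClosed (offset B r) :=
  isClosed_le (continuous_infDist_pt B) continuous_const

omit [Nontrivial (E n)] in
theorem exists_radius {T : ℝ} (hT : T ∈ Icc (volume.real B) (volume.real A)) :
    ∃ r, 0 ≤ r ∧ volume.real (offset B r ∩ A) = T := by
  have hcont : ContinuousOn (fun r => volume.real (offset B r ∩ A)) (Ici 0) := by
    refine continuousOn_volume_real
      (fun r => ((isClosed_offset B r).inter h.compact_outer.isClosed).measurableSet)
      h.compact_outer.measurableSet h.volume_outer_ne_top (fun r _ => inter_subset_right)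
      (fun r hr => ?_)
    -- At `r = 0` no null level set is needed: points at distance 0 from `B` stay in every offset of
    -- radius `y ≥ 0`.
    have hae : ∀ᵐ p ∂(volume : Measure (E n)), r = 0 ∨ infDist p B ≠ r := by
      rcases (show 0 ≤ r from hr).eq_or_lt with h0 | h0
      · exact Eventually.of_forall fun _ => Or.inl h0.symm
      · have : ∀ᵐ p ∂(volume : Measure (E n)), infDist p B ≠ r := by
          rw [ae_iff]
          simpa using h.volume_infDist_eq h0
        filter_upwards [this] with p hp using Or.inr hp
    filter_upwards [hae] with p hp
    have key : ∀ᶠ y in 𝓝[Ici 0] r, (infDist p B ≤ y ↔ infDist p B ≤ r) := by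
      by_cases heq : infDist p B = r
      · have hr0 : r = 0 := hp.resolve_right (not_not.2 heq)
        filter_upwards [self_mem_nhdsWithin] with y hy
        simp only [heq, hr0, le_refl, iff_true]
        exact hy
      · refine Filter.Eventually.filter_mono nhdsWithin_le_nhds ?_
        rcases lt_or_gt_of_ne heq with hlt | hgt
        · filter_upwards [lt_mem_nhds hlt] with y hy
          simp [hlt.le, hy.le]
        · filter_upwards [gt_mem_nhds hgt] with y hy
          simp [hgt.not_ge, hy.not_ge]
    filter_upwards [key] with y hy
    simp only [offset, mem_inter_iff, mem_ofPred_eq, hy]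
  obtain ⟨R, hR⟩ := h.compact_outer.isBounded.subset_closedBall h.nonempty.some
  have hoff : offset B (max R 0) ∩ A = A := by
    refine inter_eq_right.2 fun p hp => ?_
    exact (infDist_le_dist_of_mem h.nonempty.some_mem).trans ((hR hp).trans (le_max_left _ _))
  have := intermediate_value_Icc (le_max_right R 0) (hcont.mono Icc_subset_Ici_self)
  simp only [h.offset_zero, hoff, inter_eq_left.2 h.subset] at this
  obtain ⟨r, hr, hr'⟩ := this hT
  exact ⟨r, hr.1, hr'⟩

omit [Nontrivial (E n)] in
theorem ci_offset_inter {r : ℝ} (hr : 0 ≤ r) :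
    RegularJordan (ci (offset B r ∩ A)) ∧ ci B ⊆ ci (offset B r ∩ A) ∧ ci (offset B r ∩ A) ⊆ A ∧
      volume.real (ci (offset B r ∩ A)) = volume.real (offset B r ∩ A) := by
  have hf : volume (frontier (offset B r ∩ A)) = 0 := by
    rcases hr.eq_or_lt with rfl | hr
    · rw [h.offset_zero, inter_eq_left.2 h.subset]
      exact h.frontier_inner
    · refine measure_mono_null ((frontier_inter_subset _ _).trans
        (union_subset_union inter_subset_left inter_subset_right))
        (measure_union_null (measure_mono_null ?_ (h.volume_infDist_eq hr)) h.frontier_outer)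
      exact frontier_le_subset_eq (continuous_infDist_pt B) continuous_const
  refine ⟨regularJordan_ci (h.compact_outer.isBounded.subset inter_subset_right) hf,
    ci_mono (subset_inter (fun p hp => ?_) h.subset),
    (ci_mono inter_subset_right).trans (ci_subset_of_isClosed h.compact_outer.isClosed),
    measureReal_congr (ci_ae_eq hf)⟩
  rw [offset, mem_ofPred_eq, infDist_zero_of_mem hp]
  exact hr

end NestedBodies

theorem RegularJordan.centers_nonempty {A : Set (E n)} (hA : RegularJordan A)
    (hne : A.Nonempty) : (centers A).Nonempty := by
  obtain ⟨q, hq, hmax⟩ := hA.isCompact.exists_isMaxOn hne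
    (lipschitz_signedDist hne hA.isCompact.ne_univ_of_nontrivial).continuous.continuousOn
  exact ⟨q, hq, fun a ha => hmax ha⟩

/-- A nonempty regular set has an interior point; the signed distance is positive there and no
larger than at a center. -/
theorem RegularJordan.signedDist_center_pos {A : Set (E n)} (hA : RegularJordan A)
    (hne : A.Nonempty) {q : E n} (hq : q ∈ centers A) : 0 < signedDist q A := by
  obtain ⟨a, ha⟩ : (interior A).Nonempty := by
    rw [nonempty_iff_ne_empty]
    intro h
    rw [hA.regular, ci, h, closure_empty] at hne
    exact not_nonempty_empty hne
  have hu := hA.isCompact.ne_univ_of_nontrivial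
  refine lt_of_lt_of_le ?_ (hq.2 a (interior_subset ha))
  refine lt_of_le_of_ne ((signedDist_nonneg_iff hA.isClosed hne hu).2 (interior_subset ha)) ?_
  intro h
  exact ((signedDist_eq_zero_iff hne hu).1 h.symm).2 ha

/-- Covers `B' = B` and, for `B = ∅`, the singleton `B'` of the center at once. -/
theorem isMean_ci_distanceAverage {A B B' : Set (E n)} {t : ℝ} (ht : t ∈ Icc (0 : ℝ) 1)
    (D : Choices n) (h : NestedBodies A B') (hB : B ⊆ ci B')
    (hvol : volume.real B = volume.real B') (hlev : levelFun D.center A B = mixedDist A B')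
    (hzero : ZeroMeasureCondition D.center A B) :
    IsMean t A B (ci (distanceAverage D.center A B (D.param A B t))) := by
  have hz : ∀ x ∈ Icc (0 : ℝ) 1, volume {p | mixedDist A B' x p = 0} = 0 := by
    intro x hx
    by_cases hx2 : x = 1 / 2
    · rw [ZeroMeasureCondition, hlev] at hzero
      rw [hx2, hzero]
    · exact h.volume_mixedDist_eq_zero hx hx2
  have hT : targetMeasure A B t ∈ Icc (volume.real B') (volume.real A) := by
    have hle := h.volume_real_le
    rw [← hvol] at hle ⊢
    exact targetMeasure_mem ht hle
  have hset (x : ℝ) : distanceAverage D.center A B x = {p | 0 ≤ mixedDist A B' x p} := by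
    rw [distanceAverage, if_neg fun hc => h.outer_nonempty.ne_empty hc.1, hlev]
  have hN := D.one_lt_N
  obtain ⟨x, hx, hxT⟩ := h.exists_volume_real_mixedDist_eq hz hT
  have hxI : x ∈ Icc (-D.N) D.N := ⟨by linarith [hx.1], by linarith [hx.2]⟩
  have hx0 : |distanceAverageMeasure D.center A B x - targetMeasure A B t| = 0 := by
    rw [distanceAverageMeasure, hset, hxT, sub_self, abs_zero]
  -- Some `x ∈ [0, 1] ⊆ [-N, N]` has error 0, so every minimizer has error 0.
  have hmem := D.param_mem A B t ⟨x, hxI, fun ξ _ => hx0.le.trans (abs_nonneg _)⟩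
  have hg := (hmem.2 x hxI).trans hx0.le
  rw [abs_nonpos_iff, sub_eq_zero, distanceAverageMeasure, hset] at hg
  obtain ⟨h1, h2, h3, h4⟩ := h.ci_setOf_mixedDist hz hT hg
  rw [hset]
  exact ⟨h1, hB.trans h2, h3, h4⟩

theorem isMean_simpleAverage (D : Choices n) {t : ℝ} (ht : t ∈ Icc (0 : ℝ) 1) {A B : Set (E n)}
    (hA : RegularJordan A) (hB : RegularJordan B) (hBA : B ⊆ A) :
    IsMean t A B (simpleAverage D t A B) := by
  rcases A.eq_empty_or_nonempty with rfl | hAne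
  · obtain rfl : B = ∅ := subset_empty_iff.1 hBA
    have : simpleAverage D t ∅ ∅ = ∅ := by
      unfold simpleAverage
      split_ifs
      · rw [distanceAverage, if_pos ⟨rfl, rfl⟩, ci_empty]
      · rw [inter_empty, ci_empty]
    rw [this]
    exact ⟨regularJordan_empty, subset_rfl, subset_rfl, by simp [targetMeasure]⟩
  rcases B.eq_empty_or_nonempty with rfl | hBne
  · have hq := D.center_mem A (hA.centers_nonempty hAne)
    set q := D.center A with hqdef
    have h : NestedBodies A {q} := ⟨hA.isCompact, isCompact_singleton, by simpa using hq.1,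
      singleton_nonempty q, hA.jordan,
      measure_mono_null (isClosed_singleton.frontier_subset) (measure_singleton q)⟩
    have hlev : levelFun D.center A ∅ = mixedDist A {q} := by
      funext x p
      rw [levelFun, mixedDist, partnerDist, partnerDist, if_neg hAne.ne_empty, if_pos rfl,
        signedDist_singleton]
    -- Hence the offset branch, in which `infDist` to `∅` would be the default value 0, never occurs
    -- here.
    have hzero : ZeroMeasureCondition D.center A ∅ := by
      rw [ZeroMeasureCondition, hlev]
      exact volume_mixedDist_singleton_eq_zero h (hA.signedDist_center_pos hAne hq)
    rw [simpleAverage, if_pos hzero]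
    exact isMean_ci_distanceAverage ht D h (empty_subset _) (by simp [Measure.real]) hlev hzero
  · have h : NestedBodies A B := ⟨hA.isCompact, hB.isCompact, hBA, hBne, hA.jordan, hB.jordan⟩
    have hlev : levelFun D.center A B = mixedDist A B := by
      funext x p
      rw [levelFun, mixedDist, partnerDist, partnerDist, if_neg hAne.ne_empty,
        if_neg hBne.ne_empty]
    unfold simpleAverage
    split_ifs with hzero
    · exact isMean_ci_distanceAverage ht D h hB.regular.le rfl hlev hzero
    · obtain ⟨hr0, hr⟩ := D.radius_mem A B t
        (h.exists_radius (targetMeasure_mem ht h.volume_real_le))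
      obtain ⟨h1, h2, h3, h4⟩ := h.ci_offset_inter hr0
      exact ⟨h1, hB.regular.le.trans h2, h3, h4.trans hr⟩

end SetSpline

/-! ### Components of the difference and the nested average -/

namespace SetSpline

open Filter Topology Metric

variable {n : ℕ}

theorem RegularJordan.union {A B : Set (E n)} (hA : RegularJordan A) (hB : RegularJordan B) :
    RegularJordan (A ∪ B) where
  bounded := hA.bounded.union hB.bounded
  regular := by
    refine Subset.antisymm (union_subset ?_ ?_)
      (ci_subset_of_isClosed (hA.isClosed.union hB.isClosed))
    · conv_lhs => rw [hA.regular]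
      exact ci_mono subset_union_left
    · conv_lhs => rw [hB.regular]
      exact ci_mono subset_union_right
  jordan := measure_mono_null ((frontier_union_subset _ _).trans
    (union_subset_union inter_subset_left inter_subset_right))
    (measure_union_null hA.jordan hB.jordan)

theorem RegularJordan.biUnion_finset {ι : Type*} (s : Finset ι) (X : ι → Set (E n))
    (h : ∀ i ∈ s, RegularJordan (X i)) : RegularJordan (⋃ i ∈ s, X i) := by
  classical
  induction s using Finset.induction_on with
  | empty => simpa using regularJordan_empty
  | insert a s ha ih =>
    rw [Finset.set_biUnion_insert]
    exact (h a (Finset.mem_insert_self a s)).union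
      (ih fun i hi => h i (Finset.mem_insert_of_mem hi))

theorem eq_of_mem_components {S K K' : Set (E n)} (hK : K ∈ components S)
    (hK' : K' ∈ components S) {p : E n} (hp : p ∈ K) (hp' : p ∈ K') : K = K' := by
  obtain ⟨q, -, rfl⟩ := hK
  obtain ⟨q', -, rfl⟩ := hK'
  rw [connectedComponentIn_eq hp, connectedComponentIn_eq hp']

theorem subset_of_mem_components {S K : Set (E n)} (hK : K ∈ components S) : K ⊆ S := by
  obtain ⟨q, -, rfl⟩ := hK
  exact connectedComponentIn_subset S q

theorem sUnion_components (S : Set (E n)) : ⋃₀ components S = S := by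
  refine Subset.antisymm (sUnion_subset fun K hK => subset_of_mem_components hK) fun p hp => ?_
  exact mem_sUnion.2 ⟨_, ⟨p, hp, rfl⟩, mem_connectedComponentIn hp⟩

/-- A point of `A` off both boundaries is interior to `B` or to `A \ B`. In the latter case its
component is a neighbourhood, by local connectedness, and is either a member of `𝒞` or disjoint from
all members. -/
theorem frontier_union_sUnion_components {A B : Set (E n)} (hA : IsClosed A) (hB : IsClosed B)
    (hBA : B ⊆ A) {𝒞 : Set (Set (E n))} (h𝒞 : 𝒞 ⊆ components (A \ B)) :
    frontier (B ∪ ⋃₀ 𝒞) ⊆ frontier A ∪ frontier B := by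
  intro p hp
  by_contra hf
  have hfA : p ∉ frontier A := fun h => hf (Or.inl h)
  have hfB : p ∉ frontier B := fun h => hf (Or.inr h)
  have hsub : B ∪ ⋃₀ 𝒞 ⊆ A := union_subset hBA
    (sUnion_subset fun K hK => (subset_of_mem_components (h𝒞 hK)).trans sdiff_subset)
  have hpA : p ∈ A := hA.closure_subset_iff.2 hsub hp.1
  have hpi : p ∈ interior A := by rw [← self_sdiff_frontier]; exact ⟨hpA, hfA⟩
  by_cases hpB : p ∈ B
  · have hpiB : p ∈ interior B := by rw [← self_sdiff_frontier]; exact ⟨hpB, hfB⟩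
    exact hp.2 (interior_mono subset_union_left hpiB)
  have hnhds : connectedComponentIn (A \ B) p ∈ 𝓝 p := connectedComponentIn_mem_nhds
    (inter_mem (mem_interior_iff_mem_nhds.1 hpi) (hB.isOpen_compl.mem_nhds hpB))
  have hcomp : connectedComponentIn (A \ B) p ∈ components (A \ B) := ⟨p, ⟨hpA, hpB⟩, rfl⟩
  by_cases hmem : connectedComponentIn (A \ B) p ∈ 𝒞
  · exact hp.2 (mem_interior_iff_mem_nhds.2
      (mem_of_superset hnhds ((subset_sUnion_of_mem hmem).trans subset_union_right)))
  · obtain ⟨q, hq, hq'⟩ := mem_closure_iff_nhds.1 hp.1 _ hnhds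
    rcases hq' with hqB | ⟨K, hK, hqK⟩
    · exact (connectedComponentIn_subset _ _ hq).2 hqB
    · exact hmem (eq_of_mem_components hcomp (h𝒞 hK) hq hqK ▸ hK)

theorem volume_frontier_union_sUnion_components {A B : Set (E n)} (hA : RegularJordan A)
    (hB : RegularJordan B) (hBA : B ⊆ A) {𝒞 : Set (Set (E n))} (h𝒞 : 𝒞 ⊆ components (A \ B)) :
    volume (frontier (B ∪ ⋃₀ 𝒞)) = 0 :=
  measure_mono_null (frontier_union_sUnion_components hA.isClosed hB.isClosed hBA h𝒞)
    (measure_union_null hA.jordan hB.jordan)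

/-- Follows from the null boundary, so `𝒞` need not be countable. -/
theorem nullMeasurableSet_sUnion_components {A B : Set (E n)} (hA : RegularJordan A)
    (hB : RegularJordan B) (hBA : B ⊆ A) {𝒞 : Set (Set (E n))} (h𝒞 : 𝒞 ⊆ components (A \ B)) :
    NullMeasurableSet (⋃₀ 𝒞) volume := by
  have h1 := nullMeasurableSet_of_null_frontier
    (volume_frontier_union_sUnion_components hA hB hBA h𝒞)
  have : ⋃₀ 𝒞 = (B ∪ ⋃₀ 𝒞) \ B := by
    rw [union_sdiff_left, eq_comm, sdiff_eq_left, disjoint_left]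
    rintro p ⟨K, hK, hp⟩
    exact (subset_of_mem_components (h𝒞 hK) hp).2
  rw [this]
  exact h1.diff hB.measurableSet.nullMeasurableSet

theorem finite_large_components {A B : Set (E n)} (hA : RegularJordan A) (hB : RegularJordan B)
    (hBA : B ⊆ A) {ε : ℝ} (hε : 0 < ε) :
    {C | C ∈ components (A \ B) ∧ ε ≤ volume.real C}.Finite := by
  have h := Measure.finite_const_le_meas_of_disjoint_iUnion₀ (volume : Measure (E n))
    (ENNReal.ofReal_pos.2 hε) (As := fun C : components (A \ B) => (C : Set (E n))) ?_ ?_ ?_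
  · refine (h.image Subtype.val).subset ?_
    rintro C ⟨hC, hCε⟩
    refine ⟨⟨C, hC⟩, ?_, rfl⟩
    exact ENNReal.ofReal_le_of_le_toReal hCε
  · rintro ⟨C, hC⟩
    have := nullMeasurableSet_sUnion_components hA hB hBA (𝒞 := {C}) (singleton_subset_iff.2 hC)
    rwa [sUnion_singleton] at this
  · rintro ⟨C, hC⟩ ⟨C', hC'⟩ hne
    refine Disjoint.aedisjoint (disjoint_left.2 fun p hp hp' => hne ?_)
    exact Subtype.ext (eq_of_mem_components hC hC' hp hp')
  · refine measure_ne_top_of_subset (iUnion_subset fun C => ?_) hA.volume_ne_top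
    exact (subset_of_mem_components C.2).trans sdiff_subset

theorem exists_eq_sUnion_of_mem_parts {ε : ℝ} {A B C : Set (E n)} (hC : C ∈ parts ε A B) :
    ∃ 𝒞 ⊆ components (A \ B), C = ⋃₀ 𝒞 := by
  unfold parts at hC
  split_ifs at hC
  · exact ⟨{C}, singleton_subset_iff.2 hC, (sUnion_singleton C).symm⟩
  · rcases hC with hC | hC
    · exact ⟨{C}, singleton_subset_iff.2 hC.1, (sUnion_singleton C).symm⟩
    · exact ⟨_, fun K hK => hK.1, hC⟩

theorem finite_parts {A B : Set (E n)} (hA : RegularJordan A) (hB : RegularJordan B)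
    (hBA : B ⊆ A) {ε : ℝ} (hε : 0 < ε) : (parts ε A B).Finite := by
  unfold parts
  split_ifs with h
  · exact h
  · exact (finite_large_components hA hB hBA hε).union (finite_singleton _)

theorem sUnion_parts (ε : ℝ) (A B : Set (E n)) : ⋃₀ parts ε A B = A \ B := by
  unfold parts
  split_ifs
  · exact sUnion_components _
  · rw [sUnion_union, sUnion_singleton, ← sUnion_union]
    conv_rhs => rw [← sUnion_components (A \ B)]
    congr 1
    ext K
    simp only [mem_union, mem_ofPred_eq, ← and_or_left, and_iff_left_iff_imp]
    exact fun _ => le_or_gt _ _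

theorem pairwiseDisjoint_parts (ε : ℝ) (A B : Set (E n)) :
    (parts ε A B).PairwiseDisjoint id := by
  intro C hC C' hC' hne
  refine disjoint_left.2 fun p hp hp' => hne ?_
  unfold parts at hC hC'
  split_ifs at hC hC'
  · exact eq_of_mem_components hC hC' hp hp'
  rcases hC with hC | hC <;> rcases hC' with hC' | hC'
  · exact eq_of_mem_components hC.1 hC'.1 hp hp'
  · rw [mem_singleton_iff] at hC'
    subst hC'
    obtain ⟨K, hK, hpK⟩ := hp'
    have := eq_of_mem_components hC.1 hK.1 hp hpK
    exact absurd hC.2 (this ▸ hK.2.not_ge)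
  · rw [mem_singleton_iff] at hC
    subst hC
    obtain ⟨K, hK, hpK⟩ := hp
    have := eq_of_mem_components hC'.1 hK.1 hp' hpK
    exact absurd hC'.2 (this ▸ hK.2.not_ge)
  · exact (mem_singleton_iff.1 hC).trans (mem_singleton_iff.1 hC').symm

variable [Nontrivial (E n)]

/-- Outside `B`, the part `C` contributes exactly `t μ(C)`. The contributions overlap only in null
sets, so over the finitely many parts they add up to `t μ(A \ B)`. -/
theorem isMean_nestedAverage (D : Choices n) {t : ℝ} (ht : t ∈ Icc (0 : ℝ) 1) {A B : Set (E n)}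
    (hA : RegularJordan A) (hB : RegularJordan B) (hBA : B ⊆ A) :
    IsMean t A B (nestedAverage D t A B) := by
  unfold nestedAverage
  split_ifs with hAB
  · subst hAB
    exact ⟨hA, subset_rfl, subset_rfl, by unfold targetMeasure; ring⟩
  have hfin := finite_parts hA hB hBA D.ε_pos
  obtain ⟨s, hs⟩ : ∃ s : Finset (Set (E n)), (s : Set (Set (E n))) = parts D.ε A B :=
    ⟨hfin.toFinset, hfin.coe_toFinset⟩
  have hmem (C : Set (E n)) : C ∈ parts D.ε A B ↔ C ∈ s := by rw [← hs, Finset.mem_coe]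
  have hcover : ⋃ C ∈ s, C = A \ B := by
    rw [← sUnion_parts D.ε A B, sUnion_eq_biUnion]
    simp only [hmem]
  have hCsub : ∀ C ∈ s, C ⊆ A \ B := fun C hC => hcover ▸ subset_biUnion_of_mem (u := id) hC
  have hfr : ∀ C ∈ s, volume (frontier (B ∪ C)) = 0 := fun C hC => by
    obtain ⟨𝒞, h𝒞, rfl⟩ := exists_eq_sUnion_of_mem_parts ((hmem C).2 hC)
    exact volume_frontier_union_sUnion_components hA hB hBA h𝒞
  have hnm : ∀ C ∈ s, NullMeasurableSet C volume := fun C hC => by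
    obtain ⟨𝒞, h𝒞, rfl⟩ := exists_eq_sUnion_of_mem_parts ((hmem C).2 hC)
    exact nullMeasurableSet_sUnion_components hA hB hBA h𝒞
  have hsubA : ∀ C ∈ s, B ∪ C ⊆ A := fun C hC =>
    union_subset hBA ((hCsub C hC).trans sdiff_subset)
  have hRJ : ∀ C ∈ s, RegularJordan (ci (B ∪ C)) := fun C hC =>
    regularJordan_ci (hA.bounded.subset (hsubA C hC)) (hfr C hC)
  have hmean : ∀ C ∈ s, IsMean t (ci (B ∪ C)) B (simpleAverage D t (ci (B ∪ C)) B) :=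
    fun C hC => isMean_simpleAverage D ht (hRJ C hC) hB
      (hB.regular.le.trans (ci_mono subset_union_left))
  have hciA : ∀ C ∈ s, ci (B ∪ C) ⊆ A := fun C hC =>
    (ci_mono (hsubA C hC)).trans (ci_subset_of_isClosed hA.isClosed)
  have hfinA : ∀ {X : Set (E n)}, X ⊆ A → volume X ≠ ⊤ := fun hX =>
    measure_ne_top_of_subset hX hA.volume_ne_top
  have hvolC : ∀ C ∈ s, volume.real (simpleAverage D t (ci (B ∪ C)) B \ B) =
      t * volume.real C := fun C hC => by
    rw [measureReal_sdiff (hmean C hC).inner_subset hB.measurableSet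
      (hfinA ((hmean C hC).subset_outer.trans (hciA C hC))), (hmean C hC).measure, targetMeasure,
      measureReal_congr (ci_ae_eq (hfr C hC)), measureReal_union₀ (hnm C hC)
      (disjoint_left.2 fun p hp hp' => (hCsub C hC hp').2 hp).aedisjoint (hfinA hBA)
      (hfinA ((hCsub C hC).trans sdiff_subset))]
    ring
  have hdisj : (s : Set (Set (E n))).PairwiseDisjoint id := hs ▸ pairwiseDisjoint_parts D.ε A B
  have hsum : volume.real (A \ B) = ∑ C ∈ s, volume.real C := by
    rw [← hcover]
    exact measureReal_biUnion_finset₀ hdisj.aedisjoint hnm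
      fun C hC => hfinA ((hCsub C hC).trans sdiff_subset)
  have hunion : (⋃ C ∈ parts D.ε A B, simpleAverage D t (ci (B ∪ C)) B) =
      ⋃ C ∈ s, simpleAverage D t (ci (B ∪ C)) B := by simp only [hmem]
  rw [hunion]
  have hsubM : (⋃ C ∈ s, simpleAverage D t (ci (B ∪ C)) B) ⊆ A :=
    iUnion₂_subset fun C hC => (hmean C hC).subset_outer.trans (hciA C hC)
  -- A union over no parts would lose `B`; `A ≠ B` guarantees at least one part.
  have hBM : B ⊆ ⋃ C ∈ s, simpleAverage D t (ci (B ∪ C)) B := by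
    have : (A \ B).Nonempty := by
      rw [sdiff_nonempty]
      exact fun h => hAB (h.antisymm hBA)
    obtain ⟨p, hp⟩ := this
    rw [← hcover] at hp
    obtain ⟨C, hC, -⟩ := mem_iUnion₂.1 hp
    exact (hmean C hC).inner_subset.trans
      (subset_biUnion_of_mem (u := fun C => simpleAverage D t (ci (B ∪ C)) B) hC)
  refine ⟨RegularJordan.biUnion_finset _ _ fun C hC => (hmean C hC).regularJordan, hBM, hsubM, ?_⟩
  have hdiff : volume.real ((⋃ C ∈ s, simpleAverage D t (ci (B ∪ C)) B) \ B) =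
      t * volume.real (A \ B) := by
    simp only [iUnion_sdiff]
    rw [measureReal_biUnion_finset₀ (h := fun C hC => hfinA (sdiff_subset.trans
      ((hmean C hC).subset_outer.trans (hciA C hC)))), Finset.sum_congr rfl hvolC, hsum, Finset.mul_sum]
    -- A common point outside `B` misses `C` or `C'`, as these are disjoint, and so lies in the null
    -- excess of `ci (B ∪ C)` over `B ∪ C` or in that for `C'`.
    · intro C hC C' hC' hne
      refine measure_mono_null (t := (ci (B ∪ C) \ (B ∪ C)) ∪ (ci (B ∪ C') \ (B ∪ C'))) ?_
        (measure_union_null (ae_le_set.1 (ci_ae_eq (hfr C hC)).le)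
          (ae_le_set.1 (ci_ae_eq (hfr C' hC')).le))
      rintro p ⟨⟨h1, h1B⟩, ⟨h2, -⟩⟩
      by_cases hpC : p ∈ C
      · refine Or.inr ⟨(hmean C' hC').subset_outer h2, ?_⟩
        rintro (h | h)
        · exact h1B h
        · exact disjoint_left.1 (hdisj hC hC' hne) hpC h
      · refine Or.inl ⟨(hmean C hC).subset_outer h1, ?_⟩
        rintro (h | h)
        · exact h1B h
        · exact hpC h
    · exact fun C hC => ((hmean C hC).regularJordan.measurableSet.diff
        hB.measurableSet).nullMeasurableSet
  rw [measureReal_sdiff hBM hB.measurableSet (hfinA hsubM),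
    measureReal_sdiff hBA hB.measurableSet hA.volume_ne_top] at hdiff
  rw [targetMeasure]
  linarith

omit [Nontrivial (E n)] in
theorem measureAverage_comm (D : Choices n) (t : ℝ) (A B : Set (E n)) :
    measureAverage D t A B = measureAverage D (1 - t) B A := by
  rw [measureAverage, measureAverage, sub_sub_cancel, inter_comm B A, union_comm]

theorem isMean_measureAverage (D : Choices n) {t : ℝ} (ht : t ∈ Icc (0 : ℝ) 1) {A B : Set (E n)}
    (hA : RegularJordan A) (hB : RegularJordan B) (hBA : B ⊆ A) :
    IsMean t A B (measureAverage D t A B) := by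
  have h := isMean_nestedAverage D ht hA hB hBA
  rw [measureAverage, inter_eq_right.2 hBA, ← hB.regular]
  have : nestedAverage D (1 - t) B B = B := if_pos rfl
  rwa [this, union_eq_left.2 h.inner_subset]

end SetSpline

/-! ### Monotone sequences under refinement -/

namespace SetSpline

open Filter Topology Metric

variable {n : ℕ}

/-- The relation is inclusion or reverse inclusion. -/
def IsNesting (r : Set (E n) → Set (E n) → Prop) : Prop :=
  r = (fun A B => A ⊆ B) ∨ r = fun A B => B ⊆ A

/-- A bi-infinite sequence of regular Jordan sets that is monotone for the relation `r`. -/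
structure IsChain (r : Set (E n) → Set (E n) → Prop) (F : ℤ → Set (E n)) : Prop where
  regularJordan : ∀ i, RegularJordan (F i)
  rel_succ : ∀ i, r (F i) (F (i + 1))

/-- The distances of consecutive elements of a sequence of sets. -/
noncomputable def gap (F : ℤ → Set (E n)) (i : ℤ) : ℝ := volume.real (F i ∆ F (i + 1))

namespace IsNesting

variable {r : Set (E n) → Set (E n) → Prop} (hr : IsNesting r)
include hr

theorem refl (A : Set (E n)) : r A A := by
  rcases hr with rfl | rfl
  · exact subset_rfl
  · exact subset_rfl

theorem trans {A B C : Set (E n)} (h : r A B) (h' : r B C) : r A C := by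
  rcases hr with rfl | rfl
  · exact Subset.trans h h'
  · exact Subset.trans h' h

theorem symmDiff_subset {P X Y Q : Set (E n)} (hPX : r P X) (hXQ : r X Q) (hPY : r P Y)
    (hYQ : r Y Q) : X ∆ Y ⊆ P ∆ Q := by
  rcases hr with rfl | rfl
  · rintro p (⟨h1, h2⟩ | ⟨h1, h2⟩)
    · exact Or.inr ⟨hXQ h1, fun h => h2 (hPY h)⟩
    · exact Or.inr ⟨hYQ h1, fun h => h2 (hPX h)⟩
  · rintro p (⟨h1, h2⟩ | ⟨h1, h2⟩)
    · exact Or.inl ⟨hPX h1, fun h => h2 (hYQ h)⟩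
    · exact Or.inl ⟨hPY h1, fun h => h2 (hXQ h)⟩

end IsNesting

theorem symmDiff_ne_top {A B : Set (E n)} (hA : volume A ≠ ⊤) (hB : volume B ≠ ⊤) :
    volume (A ∆ B) ≠ ⊤ :=
  measure_ne_top_of_subset symmDiff_subset_union (measure_union_ne_top hA hB)

theorem volume_real_symmDiff_of_subset {A B : Set (E n)} (hA : RegularJordan A)
    (hB : RegularJordan B) (h : B ⊆ A) :
    volume.real (A ∆ B) = volume.real A - volume.real B := by
  rw [Set.symmDiff_def, sdiff_eq_empty.2 h, union_empty,
    measureReal_sdiff h hB.measurableSet hA.volume_ne_top]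

section Average

variable [Nontrivial (E n)]
variable {r : Set (E n) → Set (E n) → Prop} (hr : IsNesting r)
include hr

/-- For nested sets `d_μ` is a difference of measures, so the exact measure of the average becomes
exact proportions of distances. The increasing case is the decreasing one with the roles of the sets
and weights exchanged. -/
theorem measureAverage_spec (D : Choices n) {t : ℝ} (ht : t ∈ Icc (0 : ℝ) 1) {A B : Set (E n)}
    (hA : RegularJordan A) (hB : RegularJordan B) (hAB : r A B) :
    RegularJordan (measureAverage D t A B) ∧ r A (measureAverage D t A B) ∧
      r (measureAverage D t A B) B ∧
      volume.real (A ∆ measureAverage D t A B) = (1 - t) * volume.real (A ∆ B) ∧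
      volume.real (measureAverage D t A B ∆ B) = t * volume.real (A ∆ B) := by
  rcases hr with rfl | rfl
  · have ht' : 1 - t ∈ Icc (0 : ℝ) 1 := ⟨by linarith [ht.2], by linarith [ht.1]⟩
    have h := isMean_measureAverage D ht' hB hA hAB
    rw [← measureAverage_comm] at h
    have hm := h.measure
    unfold targetMeasure at hm
    refine ⟨h.regularJordan, h.inner_subset, h.subset_outer, ?_, ?_⟩
    · rw [symmDiff_comm A, symmDiff_comm A,
        volume_real_symmDiff_of_subset h.regularJordan hA h.inner_subset,
        volume_real_symmDiff_of_subset hB hA hAB]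
      linarith
    · rw [symmDiff_comm _ B, symmDiff_comm A,
        volume_real_symmDiff_of_subset hB h.regularJordan h.subset_outer,
        volume_real_symmDiff_of_subset hB hA hAB]
      linarith
  · have h := isMean_measureAverage D ht hA hB hAB
    have hm := h.measure
    unfold targetMeasure at hm
    refine ⟨h.regularJordan, h.subset_outer, h.inner_subset, ?_, ?_⟩
    · rw [volume_real_symmDiff_of_subset hA h.regularJordan h.subset_outer,
        volume_real_symmDiff_of_subset hA hB hAB]
      linarith
    · rw [volume_real_symmDiff_of_subset h.regularJordan hB h.inner_subset,
        volume_real_symmDiff_of_subset hA hB hAB]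
      linarith

theorem measureAverage_half_spec (D : Choices n) {A B : Set (E n)}
    (hA : RegularJordan A) (hB : RegularJordan B) (hAB : r A B) :
    RegularJordan (measureAverage D (1 / 2) A B) ∧ r A (measureAverage D (1 / 2) A B) ∧
      r (measureAverage D (1 / 2) A B) B ∧
      volume.real (A ∆ measureAverage D (1 / 2) A B) = volume.real (A ∆ B) / 2 ∧
      volume.real (measureAverage D (1 / 2) A B ∆ B) = volume.real (A ∆ B) / 2 := by
  obtain ⟨h1, h2, h3, h4, h5⟩ := measureAverage_spec hr D (t := 1 / 2)
    ⟨by norm_num, by norm_num⟩ hA hB hAB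
  exact ⟨h1, h2, h3, by rw [h4]; ring, by rw [h5]; ring⟩

end Average

namespace IsChain

variable {r : Set (E n) → Set (E n) → Prop} (hr : IsNesting r) {F : ℤ → Set (E n)}
  (hF : IsChain r F)
include hr hF

theorem rel_add_nat (i : ℤ) (k : ℕ) : r (F i) (F (i + k)) := by
  induction k with
  | zero => simpa using hr.refl (F i)
  | succ k ih =>
    have := hr.trans ih (hF.rel_succ (i + k))
    rwa [add_assoc] at this

theorem rel_of_le {i j : ℤ} (hij : i ≤ j) : r (F i) (F j) := by
  obtain ⟨k, rfl⟩ := Int.le.dest hij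
  exact hF.rel_add_nat hr i k

omit hr in
theorem volume_real_symmDiff_le {δ : ℝ} (i : ℤ) (k : ℕ)
    (h : ∀ j, i ≤ j → j < i + k → gap F j ≤ δ) : volume.real (F i ∆ F (i + k)) ≤ k * δ := by
  induction k with
  | zero => simp
  | succ k ih =>
    have h1 := ih fun j hj hj' => h j hj (by push_cast; omega)
    have h2 : volume.real (F (i + k) ∆ F (i + k + 1)) ≤ δ :=
      h (i + k) (by omega) (by push_cast; omega)
    have h3 := measureReal_symmDiff_le (μ := volume) (s := F i) (t := F (i + k)) (F (i + k + 1))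
      (hF.regularJordan _).volume_ne_top (hF.regularJordan _).volume_ne_top
    push_cast
    rw [← add_assoc]
    linarith

variable [Nontrivial (E n)] (D : Choices n)

theorem averagingStep : IsChain r (averagingStep D F) where
  regularJordan i := (measureAverage_half_spec hr D (hF.regularJordan i) (hF.regularJordan _)
    (hF.rel_succ i)).1
  rel_succ i := hr.trans
    (measureAverage_half_spec hr D (hF.regularJordan i) (hF.regularJordan _)
      (hF.rel_succ i)).2.2.1
    (measureAverage_half_spec hr D (hF.regularJordan (i + 1)) (hF.regularJordan _)
      (hF.rel_succ (i + 1))).2.1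

/-- Triangle inequality through `F (i + 1)`, which is at half a gap from each of the two midpoints.
-/
theorem gap_averagingStep_le {δ : ℝ} {i : ℤ} (h : gap F i ≤ δ) (h' : gap F (i + 1) ≤ δ) :
    gap (SetSpline.averagingStep D F) i ≤ δ := by
  obtain ⟨h1, -, -, -, h5⟩ := measureAverage_half_spec hr D (hF.regularJordan i)
    (hF.regularJordan _) (hF.rel_succ i)
  obtain ⟨k1, -, -, k4, -⟩ := measureAverage_half_spec hr D (hF.regularJordan (i + 1))
    (hF.regularJordan _) (hF.rel_succ (i + 1))
  have h3 := measureReal_symmDiff_le (μ := volume)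
    (s := measureAverage D (1 / 2) (F i) (F (i + 1))) (t := F (i + 1))
    (measureAverage D (1 / 2) (F (i + 1)) (F (i + 1 + 1)))
    h1.volume_ne_top (hF.regularJordan _).volume_ne_top
  rw [h5, k4] at h3
  unfold gap at *
  unfold SetSpline.averagingStep
  linarith

theorem iterate_averagingStep (j : ℕ) : IsChain r ((SetSpline.averagingStep D)^[j] F) := by
  induction j with
  | zero => exact hF
  | succ j ih =>
    rw [Function.iterate_succ_apply']
    exact ih.averagingStep hr D

theorem rel_iterate_averagingStep (j : ℕ) (i : ℤ) :
    r (F i) ((SetSpline.averagingStep D)^[j] F i) ∧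
      r ((SetSpline.averagingStep D)^[j] F i) (F (i + j)) := by
  induction j generalizing i with
  | zero => simpa using hr.refl (F i)
  | succ j ih =>
    have hc := hF.iterate_averagingStep hr D j
    obtain ⟨-, h2, h3, -⟩ := measureAverage_half_spec hr D (hc.regularJordan i)
      (hc.regularJordan _) (hc.rel_succ i)
    rw [Function.iterate_succ_apply']
    refine ⟨hr.trans (ih i).1 h2, ?_⟩
    have := hr.trans h3 (ih (i + 1)).2
    rwa [show i + 1 + (j : ℤ) = i + ((j + 1 : ℕ) : ℤ) by push_cast; ring] at this

theorem gap_iterate_averagingStep_le {δ : ℝ} (j : ℕ) (i : ℤ)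
    (h : ∀ l, i ≤ l → l ≤ i + j → gap F l ≤ δ) :
    gap ((SetSpline.averagingStep D)^[j] F) i ≤ δ := by
  induction j generalizing i with
  | zero => exact h i le_rfl (by simp)
  | succ j ih =>
    rw [Function.iterate_succ_apply']
    exact (hF.iterate_averagingStep hr D j).gap_averagingStep_le hr D
      (ih i fun l hl hl' => h l hl (by push_cast; omega))
      (ih (i + 1) fun l hl hl' => h l (by omega) (by push_cast; omega))

theorem doublingStep_spec (i : ℤ) :
    RegularJordan (SetSpline.doublingStep D F i) ∧
      r (F (i / 2)) (SetSpline.doublingStep D F i) ∧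
      r (SetSpline.doublingStep D F i) (F (i / 2 + 1)) ∧
      r (SetSpline.doublingStep D F i) (SetSpline.doublingStep D F (i + 1)) ∧
      gap (SetSpline.doublingStep D F) i = gap F (i / 2) / 2 := by
  obtain ⟨h1, h2, h3, h4, h5⟩ := measureAverage_half_spec hr D (hF.regularJordan (i / 2))
    (hF.regularJordan _) (hF.rel_succ (i / 2))
  unfold gap SetSpline.doublingStep
  by_cases hi : Even i
  · have hi1 : ¬ Even (i + 1) := by rwa [Int.even_add_one, not_not]
    have hq : (i + 1) / 2 = i / 2 := by rw [Int.even_iff] at hi; omega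
    rw [if_pos hi, if_neg hi1, hq]
    exact ⟨hF.regularJordan _, hr.refl _, hF.rel_succ _, h2, h4⟩
  · have hi1 : Even (i + 1) := by rwa [Int.even_add_one]
    have hq : (i + 1) / 2 = i / 2 + 1 := by rw [Int.even_iff] at hi; omega
    rw [if_neg hi, if_pos hi1, hq]
    exact ⟨h1, h2, h3, h3, h5⟩

theorem doublingStep : IsChain r (SetSpline.doublingStep D F) where
  regularJordan i := (hF.doublingStep_spec hr D i).1
  rel_succ i := (hF.doublingStep_spec hr D i).2.2.2.1

theorem refine (m : ℕ) : IsChain r (SetSpline.refine D m F) where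
  regularJordan i := ((hF.doublingStep hr D).iterate_averagingStep hr D _).regularJordan _
  rel_succ i := by
    have := ((hF.doublingStep hr D).iterate_averagingStep hr D (m - 1)).rel_succ
      (i - (((m - 1) / 2 : ℕ) : ℤ))
    unfold SetSpline.refine
    rwa [sub_add_eq_add_sub] at this

/-- The refined set at `i` is caught between doubled sets whose indices are within `m` of `i`; the
margins are not sharp. -/
theorem rel_refine (m : ℕ) {i a b : ℤ} (ha : 2 * a + m ≤ i) (hb : i + m + 1 ≤ 2 * b) :
    r (F a) (SetSpline.refine D m F i) ∧ r (SetSpline.refine D m F i) (F b) := by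
  have hd := hF.doublingStep hr D
  obtain ⟨h1, h2⟩ := hd.rel_iterate_averagingStep hr D (m - 1) (i - (((m - 1) / 2 : ℕ) : ℤ))
  constructor
  · refine hr.trans (hF.rel_of_le hr ?_) (hr.trans (hF.doublingStep_spec hr D _).2.1 h1)
    omega
  · refine hr.trans h2 (hr.trans (hF.doublingStep_spec hr D _).2.2.1 (hF.rel_of_le hr ?_))
    omega

theorem gap_refine_le {m : ℕ} {δ : ℝ} {W : ℤ} (h : ∀ i, |i| ≤ W → gap F i ≤ δ) {i : ℤ}
    (hi : |i| + m + 1 ≤ 2 * W) : gap (SetSpline.refine D m F) i ≤ δ / 2 := by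
  have hd := hF.doublingStep hr D
  have := hd.gap_iterate_averagingStep_le hr D (δ := δ / 2) (m - 1)
    (i - (((m - 1) / 2 : ℕ) : ℤ)) fun l hl hl' => by
      rw [(hF.doublingStep_spec hr D l).2.2.2.2]
      have := h (l / 2) (by rw [abs_le]; have := abs_le.1 (le_refl |i|); omega)
      linarith
  unfold gap at *
  unfold SetSpline.refine
  rwa [sub_add_eq_add_sub] at this

theorem level (m k : ℕ) : IsChain r (SetSpline.level D m F k) := by
  induction k with
  | zero => exact hF
  | succ k ih =>
    unfold SetSpline.level at ih ⊢
    rw [Function.iterate_succ_apply']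
    exact ih.refine hr D m

omit hr hF [Nontrivial (E n)] in
theorem level_succ (m k : ℕ) :
    SetSpline.level D m F (k + 1) = SetSpline.refine D m (SetSpline.level D m F k) :=
  Function.iterate_succ_apply' _ _ _

/-- Gaps are bounded only on bounded windows. The radius `2^k L + m + 1` reproduces itself: `2^(k+1)
L + 2 (m + 1)` is twice it, which is just what `gap_refine_le` requires. -/
theorem gap_level_le {m : ℕ} {δ : ℝ} {L : ℤ} (h : ∀ i, |i| ≤ L + m + 1 → gap F i ≤ δ) (k : ℕ)
    (i : ℤ) (hi : |i| ≤ 2 ^ k * L + m + 1) : gap (SetSpline.level D m F k) i ≤ δ / 2 ^ k := by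
  induction k generalizing i with
  | zero =>
    rw [pow_zero, div_one]
    exact h i (by simpa using hi)
  | succ k ih =>
    rw [level_succ, pow_succ, ← div_div]
    refine (hF.level hr D m k).gap_refine_le hr D ih ?_
    rw [pow_succ] at hi
    linarith

theorem interpolant_spec (m k : ℕ) (x : ℝ) :
    RegularJordan (interpolant D m F k x) ∧
      r (SetSpline.level D m F k ⌊x * 2 ^ k⌋) (interpolant D m F k x) ∧
      r (interpolant D m F k x) (SetSpline.level D m F k (⌊x * 2 ^ k⌋ + 1)) := by
  have hc := hF.level hr D m k
  obtain ⟨h1, h2, h3, -⟩ := measureAverage_spec hr D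
    (t := (⌊x * 2 ^ k⌋ : ℝ) + 1 - x * 2 ^ k)
    ⟨by linarith [Int.lt_floor_add_one (x * 2 ^ k)], by linarith [Int.floor_le (x * 2 ^ k)]⟩
    (hc.regularJordan _) (hc.regularJordan _) (hc.rel_succ ⌊x * 2 ^ k⌋)
  exact ⟨h1, h2, h3⟩

/-- Both interpolants lie between the sets of level `k` with indices `i - m` and `i + m + 2`. These
are `2m + 2` gaps apart, each at most `δ / 2^k`. -/
theorem volume_real_interpolant_symmDiff_le {m : ℕ} {δ : ℝ} {L : ℕ}
    (h : ∀ i, |i| ≤ (L + 1 : ℤ) + m + 1 → gap F i ≤ δ) (k : ℕ) {x : ℝ} (hx : |x| ≤ L) :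
    volume.real (interpolant D m F k x ∆ interpolant D m F (k + 1) x) ≤
      (2 * m + 2) * δ / 2 ^ k := by
  have hc := hF.level hr D m k
  set i := ⌊x * 2 ^ k⌋ with hi
  set i' := ⌊x * 2 ^ (k + 1)⌋ with hi'
  -- The next dyadic index is `2i` or `2i + 1`.
  have h1 : 2 * i ≤ i' := by
    rw [hi', Int.le_floor, pow_succ]
    push_cast
    linarith [Int.floor_le (x * 2 ^ k)]
  have h2 : i' < 2 * i + 2 := by
    rw [hi', Int.floor_lt, pow_succ]
    push_cast
    linarith [Int.lt_floor_add_one (x * 2 ^ k)]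
  obtain ⟨hX, hPX, hXQ⟩ := hF.interpolant_spec hr D m k x
  obtain ⟨hY, hPY, hYQ⟩ := hF.interpolant_spec hr D m (k + 1) x
  rw [level_succ, ← hi'] at hPY hYQ
  rw [← hi] at hPX hXQ
  have hsub := hr.symmDiff_subset
    (hr.trans (hc.rel_of_le hr (by omega : i - m ≤ i)) hPX)
    (hr.trans hXQ (hc.rel_of_le hr (by omega : i + 1 ≤ i - m + (2 * m + 2 : ℕ))))
    (hr.trans (hc.rel_refine hr D m (a := i - m) (b := i + m + 2) (by omega) (by omega)).1 hPY)
    (hr.trans hYQ (hr.trans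
      (hc.rel_refine hr D m (a := i - m) (b := i + m + 2) (by omega) (by omega)).2
      (hc.rel_of_le hr (by omega : i + m + 2 ≤ i - m + (2 * m + 2 : ℕ)))))
  refine (measureReal_mono hsub (symmDiff_ne_top (hc.regularJordan _).volume_ne_top
    (hc.regularJordan _).volume_ne_top)).trans ?_
  have hil : -(2 ^ k * (L : ℤ)) ≤ i := by
    rw [hi, Int.le_floor]
    push_cast
    have := (abs_le.1 hx).1
    have h2k : (0 : ℝ) < 2 ^ k := by positivity
    nlinarith
  have hiu : i ≤ 2 ^ k * (L : ℤ) := by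
    have h2k : (0 : ℝ) < 2 ^ k := by positivity
    have : (i : ℝ) ≤ 2 ^ k * L := (Int.floor_le _).trans (by nlinarith [(abs_le.1 hx).2])
    exact_mod_cast this
  have h2k : (1 : ℤ) ≤ 2 ^ k := one_le_pow₀ (by norm_num)
  have := hc.volume_real_symmDiff_le (δ := δ / 2 ^ k) (i - m) (2 * m + 2) fun j hj hj' => by
    refine hF.gap_level_le hr D h k j ?_
    push_cast at hj'
    rw [abs_le]
    constructor <;> nlinarith
  refine this.trans (le_of_eq ?_)
  push_cast
  ring

omit [Nontrivial (E n)] hr hF in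
theorem exists_gap_bound (F : ℤ → Set (E n)) (W : ℤ) : ∃ δ, 0 ≤ δ ∧ ∀ i, |i| ≤ W → gap F i ≤ δ := by
  refine ⟨∑ i ∈ Finset.Icc (-W) W, gap F i, Finset.sum_nonneg fun i _ => measureReal_nonneg,
    fun i hi => ?_⟩
  exact Finset.single_le_sum (f := gap F) (fun i _ => measureReal_nonneg)
    (Finset.mem_Icc.2 (abs_le.1 hi))

end IsChain

/-! ### Existence and monotonicity of the limit -/

/-- The set of points that belong to infinitely many sets of a sequence. -/
def frequentSet (X : ℕ → Set (E n)) : Set (E n) := ⋂ N : ℕ, ⋃ k : ℕ, X (N + k)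

/-- A point outside all the later differences has constant membership from `K` on, hence the same
membership in the limsup. -/
theorem symmDiff_frequentSet_subset (X : ℕ → Set (E n)) (K : ℕ) :
    X K ∆ frequentSet X ⊆ ⋃ j : ℕ, X (K + j) ∆ X (K + j + 1) := by
  intro p hp
  by_contra hc
  simp only [mem_iUnion, not_exists, mem_symmDiff] at hc
  have hconst : ∀ j : ℕ, p ∈ X (K + j) ↔ p ∈ X K := by
    intro j
    induction j with
    | zero => simp
    | succ j ih =>
      have := hc j
      rw [← ih, ← add_assoc]
      tauto
  have hG : p ∈ frequentSet X ↔ p ∈ X K := by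
    simp only [frequentSet, mem_iInter, mem_iUnion]
    constructor
    · intro h
      obtain ⟨k, hk⟩ := h K
      exact (hconst k).1 hk
    · intro h N
      exact ⟨K, by rw [add_comm]; exact (hconst N).2 h⟩
  rw [mem_symmDiff, hG] at hp
  tauto

/-- Countable subadditivity; the final factor 2 is the sum of the geometric series. -/
theorem volume_symmDiff_frequentSet_le {X : ℕ → Set (E n)} (hX : ∀ k, volume (X k) ≠ ⊤) {c : ℝ}
    (hc : 0 ≤ c) (h : ∀ k, volume.real (X k ∆ X (k + 1)) ≤ c / 2 ^ k) (K : ℕ) :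
    volume (X K ∆ frequentSet X) ≤ ENNReal.ofReal (c / 2 ^ K * 2) := by
  refine (measure_mono (symmDiff_frequentSet_subset X K)).trans ((measure_iUnion_le _).trans ?_)
  have hs : HasSum (fun j : ℕ => c / 2 ^ K * (1 / 2 : ℝ) ^ j) (c / 2 ^ K * 2) :=
    hasSum_geometric_two.mul_left _
  rw [← hs.tsum_eq, ENNReal.ofReal_tsum_of_nonneg (fun j => by positivity) hs.summable]
  refine ENNReal.tsum_le_tsum fun j => ?_
  rw [← ENNReal.ofReal_toReal (symmDiff_ne_top (hX (K + j)) (hX (K + j + 1)))]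
  refine ENNReal.ofReal_le_ofReal ((h (K + j)).trans (le_of_eq ?_))
  rw [pow_add, one_div, inv_pow]
  field_simp

section Limit

variable [Nontrivial (E n)] {r : Set (E n) → Set (E n) → Prop} {F : ℤ → Set (E n)}

theorem IsChain.isLimit (hr : IsNesting r) (hF : IsChain r F) (D : Choices n) (m : ℕ) :
    IsLimit D m F fun x => frequentSet fun k => interpolant D m F k x := by
  have hRJ (k : ℕ) (x : ℝ) := (hF.interpolant_spec hr D m k x).1
  have hbound : ∀ R : ℝ, ∃ c : ℝ, ∀ x, |x| ≤ R → ∀ k,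
      dMu (interpolant D m F k x) (frequentSet fun k => interpolant D m F k x) ≤
        ENNReal.ofReal (c / 2 ^ k * 2) := by
    intro R
    obtain ⟨L, hL⟩ := exists_nat_ge R
    obtain ⟨δ, hδ, h⟩ := IsChain.exists_gap_bound F ((L + 1 : ℤ) + m + 1)
    refine ⟨(2 * m + 2) * δ, fun x hx k => ?_⟩
    exact volume_symmDiff_frequentSet_le (fun k => (hRJ k x).volume_ne_top) (by positivity)
      (fun k => hF.volume_real_interpolant_symmDiff_le hr D h k (hx.trans hL)) k
  refine ⟨fun x => ?_, fun x => ?_, fun R δ hδ => ?_⟩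
  · exact (MeasurableSet.iInter fun N => MeasurableSet.iUnion fun k =>
      (hRJ _ x).measurableSet).nullMeasurableSet
  · obtain ⟨c, hc⟩ := hbound |x|
    have h0 := hc x le_rfl 0
    refine lt_of_le_of_lt (measure_mono ?_) (measure_union_lt_top
      ((hRJ 0 x).volume_ne_top.lt_top) (h0.trans_lt ENNReal.ofReal_lt_top))
    intro p hp
    by_cases hpX : p ∈ interpolant D m F 0 x
    · exact Or.inl hpX
    · exact Or.inr (Or.inr ⟨hp, hpX⟩)
  · obtain ⟨c, hc⟩ := hbound R
    have hlim : Tendsto (fun k : ℕ => ENNReal.ofReal (c / 2 ^ k * 2)) atTop (𝓝 0) := by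
      have h1 : Tendsto (fun k : ℕ => c / 2 ^ k * 2) atTop (𝓝 (0 * 2)) :=
        (tendsto_const_nhds.div_atTop
          (tendsto_pow_atTop_atTop_of_one_lt (one_lt_two : (1 : ℝ) < 2))).mul_const 2
      simpa using ENNReal.tendsto_ofReal h1
    obtain ⟨K, hK⟩ := eventually_atTop.1 (hlim.eventually_le_const hδ)
    exact ⟨K, fun k hk x hx => (hc x hx k).trans (hK k hk)⟩

/-- Once `2^k (y - x) ≥ 1`, the right end of the dyadic interval of `x` does not exceed the left end
of that of `y`. -/
theorem IsChain.exists_rel_interpolant (hr : IsNesting r) (hF : IsChain r F) (D : Choices n)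
    (m : ℕ) {x y : ℝ} (hxy : x < y) :
    ∃ K, ∀ k, K ≤ k → r (interpolant D m F k x) (interpolant D m F k y) := by
  obtain ⟨K, hK⟩ := pow_unbounded_of_one_lt (1 / (y - x)) (one_lt_two : (1 : ℝ) < 2)
  refine ⟨K, fun k hk => ?_⟩
  refine hr.trans (hF.interpolant_spec hr D m k x).2.2 (hr.trans
    ((hF.level hr D m k).rel_of_le hr ?_) (hF.interpolant_spec hr D m k y).2.1)
  have h1 : 1 / (y - x) ≤ 2 ^ k := hK.le.trans (pow_le_pow_right₀ one_le_two hk)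
  rw [div_le_iff₀ (sub_pos.2 hxy)] at h1
  rw [Int.le_floor]
  push_cast
  linarith [Int.floor_le (x * 2 ^ k)]

end Limit

/-- If the approximations of two limit values are eventually nested, then so are the limits,
up to a null set. -/
theorem IsLimit.volume_sdiff_eq_zero {D : Choices n} {m : ℕ} {F : ℤ → Set (E n)}
    {G : ℝ → Set (E n)} (hG : IsLimit D m F G) {x y : ℝ}
    (h : ∃ K, ∀ k, K ≤ k → interpolant D m F k x ⊆ interpolant D m F k y) :
    volume (G x \ G y) = 0 := by
  obtain ⟨K₀, hK₀⟩ := h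
  refine le_antisymm (le_of_forall_gt_imp_ge_of_dense fun δ hδ => ?_) bot_le
  have hδ2 : 0 < δ / 2 := ENNReal.half_pos hδ.ne'
  obtain ⟨K, hK⟩ := hG.tendsto (max |x| |y|) (δ / 2) hδ2
  set k := max K₀ K
  have hx := hK k (le_max_right _ _) x (le_max_left _ _)
  have hy := hK k (le_max_right _ _) y (le_max_right _ _)
  have hsub := hK₀ k (le_max_left _ _)
  calc volume (G x \ G y)
      ≤ volume ((interpolant D m F k x ∆ G x) ∪ (interpolant D m F k y ∆ G y)) := by
        refine measure_mono fun p hp => ?_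
        by_cases hpx : p ∈ interpolant D m F k x
        · exact Or.inr (Or.inl ⟨hsub hpx, hp.2⟩)
        · exact Or.inl (Or.inr ⟨hp.1, hpx⟩)
    _ ≤ δ / 2 + δ / 2 := (measure_union_le _ _).trans (add_le_add hx hy)
    _ = δ := ENNReal.add_halves δ

end SetSpline

theorem corollary5p6 (n : ℕ) (hn : 1 ≤ n) (m : ℕ) (hm : 1 ≤ m) (D : SetSpline.Choices n)
    (F₀ : ℤ → Set (SetSpline.E n)) (hF₀ : ∀ i, SetSpline.RegularJordan (F₀ i)) :
    ((∀ i, F₀ i ⊆ F₀ (i + 1)) →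
      (∃ G : ℝ → Set (SetSpline.E n), SetSpline.IsLimit D m F₀ G) ∧
      ∀ G : ℝ → Set (SetSpline.E n), SetSpline.IsLimit D m F₀ G →
        ∀ x y : ℝ, x ≤ y → volume (G x \ G y) = 0) ∧
    ((∀ i, F₀ (i + 1) ⊆ F₀ i) →
      (∃ G : ℝ → Set (SetSpline.E n), SetSpline.IsLimit D m F₀ G) ∧
      ∀ G : ℝ → Set (SetSpline.E n), SetSpline.IsLimit D m F₀ G →
        ∀ x y : ℝ, x ≤ y → volume (G y \ G x) = 0) := by
  -- Positive dimension makes the space noncompact, so bodies are proper subsets and have a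
  -- boundary.
  have : Nonempty (Fin n) := ⟨⟨0, hn⟩⟩
  have : Nontrivial (SetSpline.E n) := inferInstance
  constructor
  · intro h
    have hr : SetSpline.IsNesting (n := n) fun A B => A ⊆ B := Or.inl rfl
    have hF : SetSpline.IsChain (fun A B => A ⊆ B) F₀ := ⟨hF₀, h⟩
    refine ⟨⟨_, hF.isLimit hr D m⟩, fun G hG x y hxy => ?_⟩
    rcases hxy.eq_or_lt with rfl | hlt
    · simp
    · exact hG.volume_sdiff_eq_zero (hF.exists_rel_interpolant hr D m hlt)
  · intro h
    have hr : SetSpline.IsNesting (n := n) fun A B => B ⊆ A := Or.inr rfl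
    have hF : SetSpline.IsChain (fun A B => B ⊆ A) F₀ := ⟨hF₀, h⟩
    refine ⟨⟨_, hF.isLimit hr D m⟩, fun G hG x y hxy => ?_⟩
    rcases hxy.eq_or_lt with rfl | hlt
    · simp
    · exact hG.volume_sdiff_eq_zero (hF.exists_rel_interpolant hr D m hlt)
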